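/- Let $n\ge1$, let $X^{(1)},\dots,X^{(n)}$ be i.i.d. $N_p(0,\Sigma_0)$ with $\Sigma_0$ positive definite and $\Sigma_{0,ii}=1$ for all $i$, let $\Theta_0=\Sigma_0^{-1}=(\theta_{0,ij})$, and let $X$ be the $n\times p$ matrix with rows $X^{(r)}$ and columns $X_1,\dots,X_p$. Put $\lambda=\sqrt{2\log p/n}$, $\beta^i_j=-\theta_{0,ij}/\theta_{0,ii}$ $(j\ne i)$, $\sigma_{V_i}^2=1/\theta_{0,ii}$ and $V_i=X_i-\sum_{j\neq i}\beta^i_jX_j$. Let $E_0=\{(i,j):i\ne j,\ \theta_{0,ij}\ne0\}$ (edge sets are sets of ordered pairs), let $s$ be the maximal node degree of the graph $E_0$, let $s_0^i$ be the smallest integer with $$\sum_{j\ne i}\min\{(\beta^i_j)^2,\lambda^2\sigma_{V_i}^2\}\le s^i_0\lambda^2\sigma_{V_i}^2,$$ and let $s_0=\max_is_0^i$, $S_{0,n}=\sum_is_0^i$. For $m\ge 1$ let $\rho_{\min}(m),\rho_{\max}(m)$ be the minimum and maximum of $\|\Sigma_0^{1/2}v\|_2^2/\|v\|_2^2$ over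 $v\ne0$ with at most $m$ nonzero entries, and $\Lambda_{\min}(m),\Lambda_{\max}(m)$ those of $\|Xv\|_2^2/(n\|v\|_2^2)$; put $\rho_{\max}(0)=0$. For $k_0>0$ let $1/K(s_0,k_0,\Sigma_0)$ be the infimum of $\|\Sigma_0^{1/2}v\|_2/\|v_J\|_2$ over $|J|\le s_0$ and $v\neq0$ with $\|v_{J^c}\|_1\le k_0\|v_J\|_1$, and define $1/K(s_0,k_0,X)$ likewise with $\|Xv\|_2/\sqrt n$ in place of $\|\Sigma_0^{1/2}v\|_2$. The condition $RE(s_0,k_0,\cdot)$ means that $1\le s_0<p$ and $1/K(s_0,k_0,\cdot)>0$. Assume $RE(s_0,4,\Sigma_0)$ and $\rho_{\min}(s)>0$. Let $0<\theta<1$, $a\ge6$, $c_0\ge4\sqrt2$, and let $d_0=c_0(1+\theta)^2\sqrt{\rho_{\max}(s)\rho_{\max}(3s_0)}$ satisfy $d_0\ge2(1+\theta)\sqrt{1+a}$ (which is automatic if $a\le7$). Let $\mathcal X$ be the event on which the following three conditions hold: (i) $RE(s_0,4,X)$ holds with $0<K(s_0,4,X)\le K(s_0,4,\Sigma_0)/(1-\theta)$;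 (ii) $1-\theta\le\|X_j\|_2/\sqrt n\le1+\theta$ for all $j$; (iii) $0<(1-\theta)\sqrt{\rho_{\min}(m)}\le\sqrt{\Lambda_{\min}(m)}\le\sqrt{\Lambda_{\max}(m)}\le(1+\theta)\sqrt{\rho_{\max}(m)}$ for all $1\le m\le\max(s,5s_0)$. Let $\mathcal C_a$ be the event that $\frac1n|\langle V_j/\sigma_{V_j},X_k\rangle|<\sqrt{1+a}\,\lambda$ for all $j\neq k$. With $K=K(s_0,4,\Sigma_0)$ define $$D=\frac{3(1+\theta)\sqrt{\rho_{\max}(s-s_0)}}{(1-\theta)\sqrt{\rho_{\min}(2s_0)}}+\frac{2(1+\theta)^4\rho_{\max}(3s_0)\rho_{\max}(s-s_0)}{d_0(1-\theta)^2\rho_{\min}(2s_0)},$$ $$D_0=\max\Big\{\frac D{d_0},\ \frac{2\sqrt2(1+\theta)K\sqrt{\rho_{\max}(s-s_0)}}{(1-\theta)d_0}+\frac{3\sqrt2K^2}{(1-\theta)^2}\Big\},$$ $$D_1=\max\Big\{\frac{4(1+\theta)^2\rho_{\max}(s-s_0)}{d_0^2},\ \Big(\frac{(1+\theta)\sqrt{\rho_{\max}(s-s_0)}}{d_0}+\frac{3K}{2(1-\theta)}\Big)^2\Big\}.$$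 For each $i$ let $\beta^i_{\rm init}$ be any minimizer of $\frac1{2n}\|X_i-\sum_{j\ne i}b_jX_j\|_2^2+d_0\lambda\sum_{j\neq i}|b_j|$. Let $D_4>0$, $t_0=D_4d_0\lambda$, $\mathcal D^i=\{j\ne i:|\beta^i_{j,\rm init}|<t_0\}$, $\mathcal D=\{(i,j):i\ne j,\ j\in\mathcal D^i,\ i\in\mathcal D^j\}$, $E=\{(i,j):i\neq j,\ (i,j)\notin\mathcal D\}$. Write $\Theta_{0,T}$ for $\Theta_0$ with all entries outside $T$ set to zero, and $\tilde\Theta_0=\mathrm{diag}(\Theta_0)+\Theta_{0,E_0\cap E}$. Then on the event $\mathcal C_a\cap\mathcal X$, $$|E|\le2(1+D_1/D_4)S_{0,n},\qquad|E\setminus E_0|\le\frac{2D_1}{D_4}S_{0,n},$$ $$\|\Theta_{0,\mathcal D}\|_F=\|\tilde\Theta_0-\Theta_0\|_F\le\sqrt{\min\{S_{0,n}\max_i\theta_{0,ii}^2,\ s_0\|\mathrm{diag}(\Theta_0)\|_F^2\}}\,\sqrt{1+(D_0+D_4)^2}\;d_0\lambda,$$ and the right-hand side equals $\sqrt{S_{0,n}(1+(D_0+D_4)^2)}\,C_{\rm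 diag}d_0\lambda$, where $C_{\rm diag}^2=\min\{\max_i\theta_{0,ii}^2,\ (s_0/S_{0,n})\|\mathrm{diag}(\Theta_0)\|_F^2\}$. In particular, if $D_4\ge D_1$, then $|E|\le4S_{0,n}$ and $|E\setminus E_0|\le2S_{0,n}$. -/

import Mathlib

open MeasureTheory ProbabilityTheory
open scoped Matrix Matrix.Norms.Frobenius

noncomputable section

namespace Gelato

variable {n p : ℕ}

/-! ### Population quantities attached to the concentration matrix `Θ = Σ₀⁻¹` -/

/-- The rate `λ = √(2 log p / n)`. -/
def lam (n p : ℕ) : ℝ := √(2 * Real.log p / n)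

/-- Coefficients `β^i_j = -θ_{ij}/θ_{ii}` (`j ≠ i`) of the regression of `X_i` on the other
variables; the entry `j = i` carries no meaning and is set to zero. -/
def regCoef (Θ : Matrix (Fin p) (Fin p) ℝ) (i j : Fin p) : ℝ :=
  if j = i then 0 else -Θ i j / Θ i i

/-- Standard deviation `σ_{V_i}` of the noise of the `i`-th regression, `σ_{V_i}² = 1/θ_{ii}`. -/
def noiseSd (Θ : Matrix (Fin p) (Fin p) ℝ) (i : Fin p) : ℝ := √(1 / Θ i i)

/-- The edge set `E₀` of the conditional independence graph, as a set of ordered pairs. -/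
def trueEdges (Θ : Matrix (Fin p) (Fin p) ℝ) : Finset (Fin p × Fin p) :=
  {e | e.1 ≠ e.2 ∧ Θ e.1 e.2 ≠ 0}

/-- The degree `s^i` of node `i`. -/
def nodeDegree (Θ : Matrix (Fin p) (Fin p) ℝ) (i : Fin p) : ℕ :=
  ({j | j ≠ i ∧ Θ i j ≠ 0} : Finset (Fin p)).card

/-- The maximal node degree `s`. -/
def maxDegree (Θ : Matrix (Fin p) (Fin p) ℝ) : ℕ :=
  Finset.univ.sup (nodeDegree Θ)

/-- The essential sparsity `s^i_0` of row `i`: the smallest integer `k` with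
`∑_{j ≠ i} min((β^i_j)², λ² Var V_i) ≤ k λ² Var V_i`. -/
def essSparsity (n : ℕ) (Θ : Matrix (Fin p) (Fin p) ℝ) (i : Fin p) : ℕ :=
  sInf {k : ℕ | ∑ j ∈ Finset.univ.erase i,
      min (regCoef Θ i j ^ 2) (lam n p ^ 2 * noiseSd Θ i ^ 2)
    ≤ k * (lam n p ^ 2 * noiseSd Θ i ^ 2)}

/-- `s_0 = max_i s^i_0`. -/
def maxEssSparsity (n : ℕ) (Θ : Matrix (Fin p) (Fin p) ℝ) : ℕ :=
  Finset.univ.sup (essSparsity n Θ)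

/-- `S_{0,n} = ∑_i s^i_0`. -/
def totalEssSparsity (n : ℕ) (Θ : Matrix (Fin p) (Fin p) ℝ) : ℕ :=
  ∑ i, essSparsity n Θ i

/-! ### Sparse and restricted eigenvalues

They are defined for a function `q` on `ℝ^p`, to be used with `q v = ‖Σ₀^{1/2} v‖₂` and with
`q v = ‖X v‖₂ / √n`. -/

/-- Euclidean norm of the subvector `v_J`. -/
def l2On (J : Finset (Fin p)) (v : Fin p → ℝ) : ℝ := √(∑ j ∈ J, v j ^ 2)

/-- `ℓ₁` norm of the subvector `v_J`. -/
def l1On (J : Finset (Fin p)) (v : Fin p → ℝ) : ℝ := ∑ j ∈ J, |v j|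

/-- `‖Σ^{1/2} v‖₂ = √(vᵀ Σ v)`. -/
def popNorm (S : Matrix (Fin p) (Fin p) ℝ) (v : Fin p → ℝ) : ℝ := √(v ⬝ᵥ S *ᵥ v)

/-- `‖X v‖₂ / √n` for an `n × p` design matrix `X`. -/
def empNorm (X : Matrix (Fin n) (Fin p) ℝ) (v : Fin p → ℝ) : ℝ :=
  √(∑ r, (X *ᵥ v) r ^ 2) / √n

/-- The values `q(v)² / ‖v‖₂²` over the nonzero `m`-sparse vectors `v`
(at most `m` nonzero entries). -/
def sparseRatios (q : (Fin p → ℝ) → ℝ) (m : ℕ) : Set ℝ :=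
  {x | ∃ v : Fin p → ℝ, v ≠ 0 ∧ ({j | v j ≠ 0} : Finset (Fin p)).card ≤ m ∧
    x = q v ^ 2 / l2On Finset.univ v ^ 2}

/-- Smallest `m`-sparse eigenvalue. -/
def sparseMin (q : (Fin p → ℝ) → ℝ) (m : ℕ) : ℝ := sInf (sparseRatios q m)

/-- Largest `m`-sparse eigenvalue (it is `0` for `m = 0`). -/
def sparseMax (q : (Fin p → ℝ) → ℝ) (m : ℕ) : ℝ := sSup (sparseRatios q m)

/-- `1 / K(s₀, k₀, q)`: the infimum of `q(v) / ‖v_J‖₂` over `|J| ≤ s₀` and `v ≠ 0` with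
`‖v_{Jᶜ}‖₁ ≤ k₀ ‖v_J‖₁`. -/
def invK (s₀ : ℕ) (k₀ : ℝ) (q : (Fin p → ℝ) → ℝ) : ℝ :=
  sInf {x | ∃ (J : Finset (Fin p)) (v : Fin p → ℝ), J.card ≤ s₀ ∧ v ≠ 0 ∧
    l1On Jᶜ v ≤ k₀ * l1On J v ∧ x = q v / l2On J v}

/-- The restricted eigenvalue constant `K(s₀, k₀, q)`. -/
def reK (s₀ : ℕ) (k₀ : ℝ) (q : (Fin p → ℝ) → ℝ) : ℝ := (invK s₀ k₀ q)⁻¹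

/-- The restricted eigenvalue condition `RE(s₀, k₀, q)`. -/
def RE (s₀ : ℕ) (k₀ : ℝ) (q : (Fin p → ℝ) → ℝ) : Prop :=
  1 ≤ s₀ ∧ s₀ < p ∧ 0 < k₀ ∧ 0 < invK s₀ k₀ q

/-! ### The good event

Each condition is a property of the realised design matrix `X`, with rows `X^{(1)},…,X^{(n)}`
and columns `X_1,…,X_p`. -/

/-- `F(θ)`: all columns have norm close to `√n`. -/
def EventF (θ : ℝ) (X : Matrix (Fin n) (Fin p) ℝ) : Prop :=
  ∀ j, 1 - θ ≤ √(∑ r, X r j ^ 2) / √n ∧ √(∑ r, X r j ^ 2) / √n ≤ 1 + θ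

/-- `R(θ)`: `RE(s₀, k₀, X)` holds with `0 < K(s₀, k₀, X) ≤ K(s₀, k₀, Σ₀)/(1 - θ)`. -/
def EventR (S : Matrix (Fin p) (Fin p) ℝ) (s₀ : ℕ) (k₀ θ : ℝ)
    (X : Matrix (Fin n) (Fin p) ℝ) : Prop :=
  RE s₀ k₀ (empNorm X) ∧ 0 < reK s₀ k₀ (empNorm X) ∧
    reK s₀ k₀ (empNorm X) ≤ reK s₀ k₀ (popNorm S) / (1 - θ)

/-- `M(θ)`: the sparse eigenvalues of `X` are within the factors `1 ± θ` (on the square-root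
scale) of those of `Σ₀`, for all orders `1 ≤ m ≤ max(s, (k₀ + 1)s₀)`. -/
def EventM (S : Matrix (Fin p) (Fin p) ℝ) (s s₀ : ℕ) (k₀ θ : ℝ)
    (X : Matrix (Fin n) (Fin p) ℝ) : Prop :=
  ∀ m : ℕ, 1 ≤ m → (m : ℝ) ≤ max (s : ℝ) ((k₀ + 1) * s₀) →
    0 < (1 - θ) * √(sparseMin (popNorm S) m) ∧
    (1 - θ) * √(sparseMin (popNorm S) m) ≤ √(sparseMin (empNorm X) m) ∧
    √(sparseMin (empNorm X) m) ≤ √(sparseMax (empNorm X) m) ∧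
    √(sparseMax (empNorm X) m) ≤ (1 + θ) * √(sparseMax (popNorm S) m)

/-- `𝒳 = R(θ) ∩ F(θ) ∩ M(θ)` for `k₀ = 4`, with `s`, `s₀` computed from `Θ₀ = Σ₀⁻¹`. -/
def EventX (S : Matrix (Fin p) (Fin p) ℝ) (θ : ℝ) (X : Matrix (Fin n) (Fin p) ℝ) : Prop :=
  EventR S (maxEssSparsity n S⁻¹) 4 θ X ∧ EventF θ X ∧
    EventM S (maxDegree S⁻¹) (maxEssSparsity n S⁻¹) 4 θ X

/-- The noise vector `V_i = X_i - ∑_{j ≠ i} β^i_j X_j`. -/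
def noise (Θ : Matrix (Fin p) (Fin p) ℝ) (X : Matrix (Fin n) (Fin p) ℝ) (i : Fin p)
    (r : Fin n) : ℝ :=
  X r i - ∑ j ∈ Finset.univ.erase i, regCoef Θ i j * X r j

/-- `C_a`: `max_{j ≠ k} |⟨V_j/σ_{V_j}, X_k⟩|/n < √(1+a) √(2 log p / n)`. -/
def EventC (Θ : Matrix (Fin p) (Fin p) ℝ) (a : ℝ) (X : Matrix (Fin n) (Fin p) ℝ) : Prop :=
  ∀ j k, k ≠ j →
    |(1 / n : ℝ) * ∑ r, noise Θ X j r / noiseSd Θ j * X r k| < √(1 + a) * lam n p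

/-! ### Constants -/

/-- `d₀ = c₀ (1+θ)² √(ρ_max(s) ρ_max(3 s₀))`. -/
def d0 (n : ℕ) (S : Matrix (Fin p) (Fin p) ℝ) (c₀ θ : ℝ) : ℝ :=
  c₀ * (1 + θ) ^ 2 * √(sparseMax (popNorm S) (maxDegree S⁻¹) *
    sparseMax (popNorm S) (3 * maxEssSparsity n S⁻¹))

/-- The auxiliary constant `D` in the definition of `D₀`. -/
def constD (n : ℕ) (S : Matrix (Fin p) (Fin p) ℝ) (c₀ θ : ℝ) : ℝ :=
  let s := maxDegree S⁻¹
  let s₀ := maxEssSparsity n S⁻¹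
  let ρmax := sparseMax (popNorm S)
  let ρmin := sparseMin (popNorm S)
  3 * (1 + θ) * √(ρmax (s - s₀)) / ((1 - θ) * √(ρmin (2 * s₀)))
    + 2 * (1 + θ) ^ 4 * ρmax (3 * s₀) * ρmax (s - s₀)
      / (d0 n S c₀ θ * (1 - θ) ^ 2 * ρmin (2 * s₀))

/-- The constant `D₀` of the oracle inequalities for the nodewise Lasso. -/
def constD0 (n : ℕ) (S : Matrix (Fin p) (Fin p) ℝ) (c₀ θ : ℝ) : ℝ :=
  let s := maxDegree S⁻¹
  let s₀ := maxEssSparsity n S⁻¹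
  let ρmax := sparseMax (popNorm S)
  let K := reK s₀ 4 (popNorm S)
  max (constD n S c₀ θ / d0 n S c₀ θ)
    (2 * √2 * (1 + θ) * (K * √(ρmax (s - s₀)) / ((1 - θ) * d0 n S c₀ θ))
      + 3 * √2 * K ^ 2 / (1 - θ) ^ 2)

/-- The constant `D₁` of the oracle inequalities for the nodewise Lasso. -/
def constD1 (n : ℕ) (S : Matrix (Fin p) (Fin p) ℝ) (c₀ θ : ℝ) : ℝ :=
  let s := maxDegree S⁻¹
  let s₀ := maxEssSparsity n S⁻¹
  let ρmax := sparseMax (popNorm S)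
  let K := reK s₀ 4 (popNorm S)
  max (4 * (1 + θ) ^ 2 * ρmax (s - s₀) / d0 n S c₀ θ ^ 2)
    (((1 + θ) * √(ρmax (s - s₀)) / d0 n S c₀ θ + 3 * K / (2 * (1 - θ))) ^ 2)

/-- `C_diag`, with
`C_diag² = min(max_i θ_{ii}², (s₀ / S_{0,n}) ‖diag Θ‖_F²)`. -/
def constCdiag (n : ℕ) (Θ : Matrix (Fin p) (Fin p) ℝ) : ℝ :=
  √(min (⨆ i, Θ i i ^ 2)
    ((maxEssSparsity n Θ : ℝ) / totalEssSparsity n Θ * ‖Matrix.diagonal Θ.diag‖ ^ 2))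

/-! ### The nodewise Lasso, thresholding and the OR rule -/

/-- Objective of the Lasso regression of `X_i` on the other columns with penalty `μ`. The
`i`-th entry of `b` plays no role. -/
def lassoObjective (X : Matrix (Fin n) (Fin p) ℝ) (i : Fin p) (μ : ℝ) (b : Fin p → ℝ) : ℝ :=
  1 / (2 * n) * ∑ r, (X r i - ∑ j ∈ Finset.univ.erase i, b j * X r j) ^ 2
    + μ * ∑ j ∈ Finset.univ.erase i, |b j|

/-- `b` is an optimal solution of the `i`-th Lasso regression. -/
def IsLassoSolution (X : Matrix (Fin n) (Fin p) ℝ) (i : Fin p) (μ : ℝ) (b : Fin p → ℝ) : Prop :=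
  ∀ b' : Fin p → ℝ, lassoObjective X i μ b ≤ lassoObjective X i μ b'

/-- `𝒟^i`: the variables dropped from the `i`-th regression at threshold `t`. -/
def droppedAt (B : Fin p → Fin p → ℝ) (t : ℝ) (i : Fin p) : Finset (Fin p) :=
  {j | j ≠ i ∧ |B i j| < t}

/-- `𝒟`: the pairs `(i, j)`, `i ≠ j`, that are dropped from both regressions `i` and `j`. -/
def droppedPairs (B : Fin p → Fin p → ℝ) (t : ℝ) : Finset (Fin p × Fin p) :=
  {e | e.1 ≠ e.2 ∧ e.2 ∈ droppedAt B t e.1 ∧ e.1 ∈ droppedAt B t e.2}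

/-- The selected edge set `E` (OR rule), as a set of ordered pairs. -/
def selectedEdges (B : Fin p → Fin p → ℝ) (t : ℝ) : Finset (Fin p × Fin p) :=
  {e | e.1 ≠ e.2 ∧ e ∉ droppedPairs B t}

/-- `Θ_T = (θ_{ij} 1((i,j) ∈ T))`. -/
def restrict (Θ : Matrix (Fin p) (Fin p) ℝ) (T : Finset (Fin p × Fin p)) :
    Matrix (Fin p) (Fin p) ℝ :=
  Matrix.of fun i j => if (i, j) ∈ T then Θ i j else 0

/-- `Θ̃₀ = diag(Θ₀) + Θ_{0, E₀ ∩ E}`. -/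
def thetaTilde (Θ : Matrix (Fin p) (Fin p) ℝ) (E : Finset (Fin p × Fin p)) :
    Matrix (Fin p) (Fin p) ℝ :=
  Matrix.diagonal Θ.diag + restrict Θ (trueEdges Θ ∩ E)

end Gelato

end

open Gelato

namespace Gelato

variable {n p : ℕ}

/-! On the good event the argument is deterministic and runs row by row. Fix row `i`, let `k` be its
essential sparsity and `T` the indices with `|β_j| ≥ λσ`. The definition of `k` gives `|T| ≤ k` and
`‖β_{Tᶜ}‖₂² ≤ kλ²`; here `σ ≤ 1` because `Σ` has unit diagonal. The Lasso solution `b` is compared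
with `β_T` instead of `β`, so the small coefficients enter only through the bias `A =
‖Xβ_{Tᶜ}‖₂/√n`, which a sparse eigenvalue bounds by a multiple of `√k λ`.

With `h = b - β_T` and `μ = d₀λ`, the basic inequality (`lasso_basic_inequality`) leads to two cases
in `oracle_inequality`. On the cone `‖h_{Tᶜ}‖₁ ≤ 4‖h_T‖₁` the restricted eigenvalue condition
applies directly. Off the cone the bias dominates: `h` is small in prediction norm and in `ℓ₁`, and
shelling with a sparse eigenvalue turns this into a bound on `h_T`. Either way `‖b_{Tᶜ}‖₁ ≤ D₁μk`
and `‖(b-β)_T‖₂ ≤ D₀μ√k`. Only the restricted eigenvalue terms of `D₀` and `D₁` are needed for this.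

Thresholding at `t₀ = D₄μ` then keeps at most `(D₁/D₄)k` indices outside `T`, and `T` lies in the
true neighbourhood; the OR rule costs a factor 2. A dropped coefficient in `T` is at most `t₀` plus
the estimation error, and those outside `T` have total square at most `kλ²`. Since `θ_{ij} =
-θ_{ii}β_j`, multiplying by `θ_{ii}²` and summing over rows gives the Frobenius bound. -/

/-! ### Norms and restrictions of subvectors -/

theorem l2On_nonneg (J : Finset (Fin p)) (v : Fin p → ℝ) : 0 ≤ l2On J v := Real.sqrt_nonneg _

theorem l1On_nonneg (J : Finset (Fin p)) (v : Fin p → ℝ) : 0 ≤ l1On J v :=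
  Finset.sum_nonneg fun _ _ => abs_nonneg _

theorem l2On_sq (J : Finset (Fin p)) (v : Fin p → ℝ) : l2On J v ^ 2 = ∑ j ∈ J, v j ^ 2 :=
  Real.sq_sqrt (Finset.sum_nonneg fun _ _ => sq_nonneg _)

theorem l1On_add_compl (J : Finset (Fin p)) (v : Fin p → ℝ) :
    l1On J v + l1On Jᶜ v = l1On Finset.univ v :=
  Finset.sum_add_sum_compl J _

theorem l1On_le_sqrt_mul_l2On {J : Finset (Fin p)} {k : ℕ} (hJ : J.card ≤ k) (v : Fin p → ℝ) :
    l1On J v ≤ √k * l2On J v := by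
  rw [l2On, ← Real.sqrt_mul (Nat.cast_nonneg k)]
  apply Real.le_sqrt_of_sq_le
  have h := sq_sum_le_card_mul_sum_sq (s := J) (f := fun j => |v j|)
  simp only [sq_abs] at h
  refine h.trans ?_
  gcongr

/-- The vector `v` with all entries outside `J` set to zero. -/
def restrictTo (J : Finset (Fin p)) (v : Fin p → ℝ) : Fin p → ℝ := fun j => if j ∈ J then v j else 0

theorem restrictTo_add_compl (J : Finset (Fin p)) (v : Fin p → ℝ) :
    restrictTo J v + restrictTo Jᶜ v = v := by
  ext j
  by_cases h : j ∈ J <;> simp [restrictTo, h]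

theorem l2On_restrictTo (J : Finset (Fin p)) (v : Fin p → ℝ) :
    l2On Finset.univ (restrictTo J v) = l2On J v := by
  simp [l2On, restrictTo, ite_pow]

theorem l2On_self_restrictTo (J : Finset (Fin p)) (v : Fin p → ℝ) :
    l2On J (restrictTo J v) = l2On J v := by
  unfold l2On
  congr 1
  exact Finset.sum_congr rfl fun j hj => by simp [restrictTo, hj]

theorem l1On_restrictTo (J : Finset (Fin p)) (v : Fin p → ℝ) :
    l1On Finset.univ (restrictTo J v) = l1On J v := by
  simp [l1On, restrictTo, apply_ite abs]

theorem l1On_compl_restrictTo (J : Finset (Fin p)) (v : Fin p → ℝ) :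
    l1On Jᶜ (restrictTo J v) = 0 :=
  Finset.sum_eq_zero fun j hj => by simp [restrictTo, Finset.mem_compl.mp hj]

theorem card_support_restrictTo_le (J : Finset (Fin p)) (v : Fin p → ℝ) :
    ({j | restrictTo J v j ≠ 0} : Finset (Fin p)).card ≤ J.card := by
  refine Finset.card_le_card fun j hj => ?_
  by_contra h
  simp [restrictTo, h] at hj

/-! ### Quadratic forms and sparse eigenvalues -/

theorem popNorm_nonneg (S : Matrix (Fin p) (Fin p) ℝ) (v : Fin p → ℝ) : 0 ≤ popNorm S v :=
  Real.sqrt_nonneg _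

theorem empNorm_nonneg (X : Matrix (Fin n) (Fin p) ℝ) (v : Fin p → ℝ) : 0 ≤ empNorm X v :=
  div_nonneg (Real.sqrt_nonneg _) (Real.sqrt_nonneg _)

theorem empNorm_sq (X : Matrix (Fin n) (Fin p) ℝ) (v : Fin p → ℝ) :
    empNorm X v ^ 2 = 1 / n * ∑ r, (X *ᵥ v) r ^ 2 := by
  rw [empNorm, div_pow, Real.sq_sqrt (Finset.sum_nonneg fun _ _ => sq_nonneg _),
    Real.sq_sqrt (Nat.cast_nonneg n), one_div, inv_mul_eq_div]

theorem empNorm_eq_norm (X : Matrix (Fin n) (Fin p) ℝ) (v : Fin p → ℝ) :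
    empNorm X v = ‖WithLp.toLp 2 (X *ᵥ v)‖ / √n := by
  simp [empNorm, EuclideanSpace.norm_eq]

theorem empNorm_zero (X : Matrix (Fin n) (Fin p) ℝ) : empNorm X 0 = 0 := by
  simp [empNorm]

theorem empNorm_add_le (X : Matrix (Fin n) (Fin p) ℝ) (u v : Fin p → ℝ) :
    empNorm X (u + v) ≤ empNorm X u + empNorm X v := by
  simp only [empNorm_eq_norm, Matrix.mulVec_add, WithLp.toLp_add, ← add_div]
  gcongr
  exact norm_add_le _ _

theorem empNorm_neg (X : Matrix (Fin n) (Fin p) ℝ) (v : Fin p → ℝ) :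
    empNorm X (-v) = empNorm X v := by
  simp [empNorm, Matrix.mulVec_neg]

theorem inner_le_empNorm_mul (X : Matrix (Fin n) (Fin p) ℝ) (u v : Fin p → ℝ) :
    1 / n * ∑ r, (X *ᵥ u) r * (X *ᵥ v) r ≤ empNorm X u * empNorm X v := by
  have h := Real.sum_mul_le_sqrt_mul_sqrt Finset.univ (X *ᵥ u) (X *ᵥ v)
  calc 1 / n * ∑ r, (X *ᵥ u) r * (X *ᵥ v) r
      ≤ 1 / n * (√(∑ r, (X *ᵥ u) r ^ 2) * √(∑ r, (X *ᵥ v) r ^ 2)) := by gcongr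
    _ = 1 / (√n * √n) * (√(∑ r, (X *ᵥ u) r ^ 2) * √(∑ r, (X *ᵥ v) r ^ 2)) := by
        rw [Real.mul_self_sqrt (Nat.cast_nonneg n)]
    _ = empNorm X u * empNorm X v := by
        rw [empNorm, empNorm, div_mul_div_comm, one_div, inv_mul_eq_div]

/-- A crude entrywise bound, from `|v_i v_j| ≤ ‖v‖₂²`; it serves only to show that sparse ratios are
bounded. -/
theorem dotProduct_mulVec_le (M : Matrix (Fin p) (Fin p) ℝ) (v : Fin p → ℝ) :
    v ⬝ᵥ M *ᵥ v ≤ (∑ i, ∑ j, |M i j|) * ∑ j, v j ^ 2 := by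
  have hle : ∀ i, v i ^ 2 ≤ ∑ j, v j ^ 2 := fun i =>
    Finset.single_le_sum (f := fun j => v j ^ 2) (fun _ _ => sq_nonneg _) (Finset.mem_univ i)
  simp only [dotProduct, Matrix.mulVec, Finset.sum_mul]
  refine Finset.sum_le_sum fun i _ => ?_
  rw [Finset.mul_sum]
  refine Finset.sum_le_sum fun j _ => ?_
  have h1 : v i * (M i j * v j) ≤ |M i j| * (|v i| * |v j|) := by
    refine (le_abs_self _).trans_eq ?_
    rw [abs_mul, abs_mul]
    ring
  refine h1.trans (mul_le_mul_of_nonneg_left ?_ (abs_nonneg _))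
  nlinarith [hle i, hle j, sq_nonneg (|v i| - |v j|), sq_abs (v i), sq_abs (v j)]

/-- Needed because the real `sSup` of an unbounded set is 0, so `sparseMax` is a true upper bound
only once boundedness is known. -/
theorem bddAbove_sparseRatios {q : (Fin p → ℝ) → ℝ} {C : ℝ}
    (hq : ∀ v, q v ^ 2 ≤ C * ∑ j, v j ^ 2) (m : ℕ) : BddAbove (sparseRatios q m) := by
  refine ⟨C, ?_⟩
  rintro x ⟨v, hv, -, rfl⟩
  rw [l2On_sq]
  obtain ⟨j, hj⟩ := Function.ne_iff.mp hv
  have hpos : 0 < ∑ j, v j ^ 2 := Finset.sum_pos' (fun _ _ => sq_nonneg _)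
    ⟨j, Finset.mem_univ j, by simpa using sq_pos_of_ne_zero (by simpa using hj)⟩
  exact (div_le_iff₀ hpos).mpr (hq v)

theorem bddAbove_sparseRatios_popNorm {S : Matrix (Fin p) (Fin p) ℝ} (hS : S.PosDef) (m : ℕ) :
    BddAbove (sparseRatios (popNorm S) m) :=
  bddAbove_sparseRatios (C := ∑ i, ∑ j, |S i j|) (fun v => by
    rw [popNorm, Real.sq_sqrt (by simpa using hS.posSemidef.dotProduct_mulVec_nonneg v)]
    exact dotProduct_mulVec_le S v) m

theorem bddAbove_sparseRatios_empNorm (X : Matrix (Fin n) (Fin p) ℝ) (m : ℕ) :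
    BddAbove (sparseRatios (empNorm X) m) :=
  bddAbove_sparseRatios (C := 1 / n * ∑ i, ∑ j, |(Xᵀ * X) i j|) (fun v => by
    rw [empNorm_sq, mul_assoc]
    gcongr
    refine le_trans (le_of_eq ?_) (dotProduct_mulVec_le (Xᵀ * X) v)
    rw [← Matrix.mulVec_mulVec, Matrix.dotProduct_mulVec, Matrix.vecMul_transpose]
    simp [dotProduct, sq]) m

theorem le_sqrt_sparseMax_mul {q : (Fin p → ℝ) → ℝ} {m : ℕ} (hb : BddAbove (sparseRatios q m))
    (h0 : q 0 = 0) {v : Fin p → ℝ} (hv : ({j | v j ≠ 0} : Finset (Fin p)).card ≤ m) :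
    q v ≤ √(sparseMax q m) * l2On Finset.univ v := by
  rcases eq_or_ne v 0 with rfl | hne
  · rw [h0]
    exact mul_nonneg (Real.sqrt_nonneg _) (l2On_nonneg _ _)
  have hle : q v ^ 2 / l2On Finset.univ v ^ 2 ≤ sparseMax q m := le_csSup hb ⟨v, hne, hv, rfl⟩
  obtain ⟨j, hj⟩ := Function.ne_iff.mp hne
  have hpos : 0 < l2On Finset.univ v ^ 2 := by
    rw [l2On_sq]
    exact Finset.sum_pos' (fun _ _ => sq_nonneg _)
      ⟨j, Finset.mem_univ j, by simpa using sq_pos_of_ne_zero (by simpa using hj)⟩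
  rw [div_le_iff₀ hpos] at hle
  rw [← Real.sqrt_sq (l2On_nonneg Finset.univ v), ← Real.sqrt_mul' _ (sq_nonneg _)]
  exact Real.le_sqrt_of_sq_le hle

theorem popNorm_single {S : Matrix (Fin p) (Fin p) ℝ} (hS : ∀ i, S i i = 1) (j : Fin p) :
    popNorm S (Pi.single j 1) = 1 := by
  simp [popNorm, hS]

theorem l2On_single {J : Finset (Fin p)} {j : Fin p} (hj : j ∈ J) :
    l2On J (Pi.single j 1) = 1 := by
  simp [l2On, Pi.single_apply, ite_pow, hj]

/-- A standard basis vector has ratio `Σ_jj = 1`. -/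
theorem one_le_sparseMax_popNorm {S : Matrix (Fin p) (Fin p) ℝ} (hS : S.PosDef)
    (hSdiag : ∀ i, S i i = 1) (j : Fin p) {m : ℕ} (hm : 1 ≤ m) :
    1 ≤ sparseMax (popNorm S) m := by
  refine le_csSup (bddAbove_sparseRatios_popNorm hS m) ⟨Pi.single j 1, ?_, ?_, ?_⟩
  · simp
  · refine le_trans (le_of_eq ?_) hm
    rw [Finset.card_eq_one]
    exact ⟨j, by ext l; simp [Pi.single_apply]⟩
  · simp [popNorm_single hSdiag, l2On_single]

/-! ### Restricted eigenvalues -/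

theorem bddBelow_restricted {q : (Fin p → ℝ) → ℝ} (hq : ∀ v, 0 ≤ q v) (s₀ : ℕ) (k₀ : ℝ) :
    BddBelow {x | ∃ (J : Finset (Fin p)) (v : Fin p → ℝ), J.card ≤ s₀ ∧ v ≠ 0 ∧
      l1On Jᶜ v ≤ k₀ * l1On J v ∧ x = q v / l2On J v} := by
  refine ⟨0, ?_⟩
  rintro x ⟨J, v, -, -, -, rfl⟩
  exact div_nonneg (hq v) (l2On_nonneg J v)

theorem l2On_le_reK_mul {q : (Fin p → ℝ) → ℝ} (hq : ∀ v, 0 ≤ q v) {s₀ : ℕ} {k₀ : ℝ}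
    (hK : 0 < invK s₀ k₀ q) {J : Finset (Fin p)} (hJ : J.card ≤ s₀) {v : Fin p → ℝ}
    (hv : l1On Jᶜ v ≤ k₀ * l1On J v) : l2On J v ≤ reK s₀ k₀ q * q v := by
  have hnn : 0 ≤ reK s₀ k₀ q * q v := mul_nonneg (inv_nonneg.mpr hK.le) (hq v)
  rcases eq_or_ne v 0 with rfl | hne
  · refine le_trans (le_of_eq ?_) hnn
    simp [l2On]
  -- The case `v_J = 0` is separated because the ratio in `invK` would divide by zero.
  rcases (l2On_nonneg J v).eq_or_lt with h0 | hpos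
  · rwa [← h0]
  have hle : invK s₀ k₀ q ≤ q v / l2On J v :=
    csInf_le (bddBelow_restricted hq s₀ k₀) ⟨J, v, hJ, hne, hv, rfl⟩
  rw [le_div_iff₀ hpos] at hle
  rw [reK, inv_mul_eq_div, le_div_iff₀ hK]
  linarith

/-- Test with a basis vector and its singleton support: the quotient is 1, so `1/K ≤ 1`. -/
theorem one_le_reK_popNorm {S : Matrix (Fin p) (Fin p) ℝ} (hSdiag : ∀ i, S i i = 1) {s₀ : ℕ}
    {k₀ : ℝ} (h : RE s₀ k₀ (popNorm S)) : 1 ≤ reK s₀ k₀ (popNorm S) := by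
  obtain ⟨h1, h2, h3, h4⟩ := h
  let j : Fin p := ⟨0, by omega⟩
  have := l2On_le_reK_mul (popNorm_nonneg S) h4 (J := {j}) (by simpa using h1)
    (v := Pi.single j 1) (by
      have hc : l1On {j}ᶜ (Pi.single j 1 : Fin p → ℝ) = 0 :=
        Finset.sum_eq_zero fun l hl => by
          have : l ≠ j := by simpa using hl
          simp [this]
      rw [hc]
      exact mul_nonneg h3.le (l1On_nonneg _ _))
  rwa [l2On_single (by simp), popNorm_single hSdiag, mul_one] at this

/-! ### Largest entries and shelling -/

theorem exists_card_eq_forall_le (f : Fin p → ℝ) {m : ℕ} (hm : m ≤ p) :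
    ∃ J : Finset (Fin p), J.card = m ∧ ∀ j ∈ J, ∀ l ∉ J, f l ≤ f j := by
  induction m with
  | zero => exact ⟨∅, by simp, by simp⟩
  | succ m ih =>
    obtain ⟨J, hJ, hle⟩ := ih (by omega)
    have hne : Jᶜ.Nonempty := by
      rw [← Finset.card_pos, Finset.card_compl, hJ, Fintype.card_fin]
      omega
    obtain ⟨a, ha, hmax⟩ := Finset.exists_max_image Jᶜ f hne
    rw [Finset.mem_compl] at ha
    refine ⟨insert a J, by rw [Finset.card_insert_of_notMem ha, hJ], ?_⟩
    intro j hj l hl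
    rw [Finset.mem_insert, not_or] at hl
    rcases Finset.mem_insert.mp hj with rfl | hj
    · exact hmax l (by simpa using hl.2)
    · exact hle j hj l hl.2

/-- Exchange argument: the minimum of `f` on `J` bounds `f` above on `T \ J` and below on `J \ T`,
and the former set is no larger than the latter. -/
theorem sum_le_sum_of_largest {f : Fin p → ℝ} (hf : ∀ j, 0 ≤ f j) {J T : Finset (Fin p)}
    (hJ : ∀ j ∈ J, ∀ l ∉ J, f l ≤ f j) (hT : T.card ≤ J.card) (hJ0 : 0 < J.card) :
    ∑ j ∈ T, f j ≤ ∑ j ∈ J, f j := by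
  obtain ⟨a, ha, hmin⟩ := Finset.exists_min_image J f (Finset.card_pos.mp hJ0)
  have h1 : ∑ j ∈ T \ J, f j ≤ (T \ J).card • f a :=
    Finset.sum_le_card_nsmul _ _ _ fun l hl => hJ a ha l (Finset.mem_sdiff.mp hl).2
  have h2 : (J \ T).card • f a ≤ ∑ j ∈ J \ T, f j :=
    Finset.card_nsmul_le_sum _ _ _ fun l hl => hmin l (Finset.mem_sdiff.mp hl).1
  have h3 : (T \ J).card ≤ (J \ T).card := by
    have e1 := Finset.card_sdiff_add_card_inter T J
    have e2 := Finset.card_sdiff_add_card_inter J T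
    rw [Finset.inter_comm] at e2
    omega
  have h4 : (T \ J).card • f a ≤ (J \ T).card • f a := nsmul_le_nsmul_left (hf a) h3
  have e1 := Finset.sum_inter_add_sum_sdiff T J f
  have e2 := Finset.sum_inter_add_sum_sdiff J T f
  rw [Finset.inter_comm] at e2
  linarith

/-- Peel off blocks of `m` entries in decreasing order of size. Each entry of a block is at most the
mean of the preceding block, so the block has `ℓ₂` norm at most `1/√m` times the `ℓ₁` norm of its
predecessor; these `ℓ₁` norms add up to at most `‖h‖₁`. The induction is on the size of the support.
-/
theorem shelling_bound {q : (Fin p → ℝ) → ℝ} (h0 : q 0 = 0)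
    (hadd : ∀ u v, q (u + v) ≤ q u + q v) {L : ℝ} (hL : 0 ≤ L) {m : ℕ} (hm : 0 < m) (hmp : m ≤ p)
    (hsparse : ∀ v : Fin p → ℝ, ({j | v j ≠ 0} : Finset (Fin p)).card ≤ m →
      q v ≤ L * l2On Finset.univ v)
    (N : ℕ) : ∀ (h : Fin p → ℝ), ({j | h j ≠ 0} : Finset (Fin p)).card ≤ N →
    ∀ J : Finset (Fin p), J.card = m → (∀ j ∈ J, ∀ l ∉ J, |h l| ≤ |h j|) →
      q (restrictTo Jᶜ h) ≤ L * (l1On Finset.univ h / √m) := by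
  induction N with
  | zero =>
    intro h hN J _ _
    have hz : ∀ j, h j = 0 := by
      simpa [Finset.filter_eq_empty_iff] using hN
    have : restrictTo Jᶜ h = 0 := by ext j; simp [restrictTo, hz j]
    rw [this, h0]
    exact mul_nonneg hL (div_nonneg (l1On_nonneg _ _) (Real.sqrt_nonneg _))
  | succ N ih =>
    intro h hN J hJ hlarge
    have hnn : 0 ≤ L * (l1On Finset.univ h / √m) :=
      mul_nonneg hL (div_nonneg (l1On_nonneg _ _) (Real.sqrt_nonneg _))
    by_cases hzero : ∀ l ∉ J, h l = 0
    · have : restrictTo Jᶜ h = 0 := by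
        ext j
        by_cases hj : j ∈ J <;> simp [restrictTo, hj, hzero]
      rwa [this, h0]
    push Not at hzero
    obtain ⟨l, hl, hl0⟩ := hzero
    -- A nonzero entry outside `J` forces every entry in `J` to be nonzero, so removing `J` strictly
    -- shrinks the support.
    have hsupp : ({j | restrictTo Jᶜ h j ≠ 0} : Finset (Fin p)).card ≤ N := by
      obtain ⟨a, ha⟩ := Finset.card_pos.mp (hJ ▸ hm)
      have ha0 : h a ≠ 0 := by
        rw [← abs_pos]
        exact (abs_pos.mpr hl0).trans_le (hlarge a ha l hl)
      have hss : ({j | restrictTo Jᶜ h j ≠ 0} : Finset (Fin p)) ⊂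
          ({j | h j ≠ 0} : Finset (Fin p)) := by
        rw [Finset.ssubset_iff_of_subset]
        · exact ⟨a, by simpa using ha0, by simp [restrictTo, ha]⟩
        · intro j hj
          by_cases hjJ : j ∈ J <;> simp [restrictTo, hjJ] at hj ⊢
          exact hj
      have := Finset.card_lt_card hss
      omega
    set g := restrictTo Jᶜ h with hg
    obtain ⟨J', hJ', hlarge'⟩ := exists_card_eq_forall_le (fun j => |g j|) hmp
    have hind := ih g hsupp J' hJ' hlarge'
    have hm' : (0 : ℝ) < m := by exact_mod_cast hm
    have hentry : ∀ j, |g j| ≤ l1On J h / m := by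
      intro j
      by_cases hj : j ∈ J
      · simp only [hg, restrictTo, Finset.mem_compl, hj, not_true_eq_false, if_false, abs_zero]
        exact div_nonneg (l1On_nonneg _ _) hm'.le
      · simp only [hg, restrictTo, Finset.mem_compl, hj, not_false_eq_true, if_true]
        rw [le_div_iff₀ hm']
        have := Finset.card_nsmul_le_sum J (fun i => |h i|) |h j| fun i hi => hlarge i hi j hj
        rw [hJ, nsmul_eq_mul] at this
        rw [l1On]
        linarith
    have hl2 : l2On J' g ≤ l1On J h / √m := by
      rw [l2On]
      apply Real.sqrt_le_iff.mpr
      refine ⟨div_nonneg (l1On_nonneg _ _) (Real.sqrt_nonneg _), ?_⟩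
      have h1 : ∑ j ∈ J', g j ^ 2 ≤ J'.card • (l1On J h / m) ^ 2 :=
        Finset.sum_le_card_nsmul _ _ _ fun j _ => by
          rw [← sq_abs]
          exact pow_le_pow_left₀ (abs_nonneg _) (hentry j) 2
      refine h1.trans_eq ?_
      rw [hJ', nsmul_eq_mul, div_pow, div_pow, Real.sq_sqrt hm'.le]
      field_simp
    have hfirst : q (restrictTo J' g) ≤ L * (l1On J h / √m) := by
      refine (hsparse _ ((card_support_restrictTo_le J' g).trans hJ'.le)).trans ?_
      rw [l2On_restrictTo]
      gcongr
    have hsum : l1On J h + l1On Finset.univ g = l1On Finset.univ h := by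
      rw [hg, l1On_restrictTo, l1On_add_compl]
    calc q g = q (restrictTo J' g + restrictTo J'ᶜ g) := by rw [restrictTo_add_compl]
      _ ≤ L * (l1On J h / √m) + L * (l1On Finset.univ g / √m) :=
        (hadd _ _).trans (add_le_add hfirst hind)
      _ = L * (l1On Finset.univ h / √m) := by rw [← hsum]; ring

/-! ### The deterministic oracle inequality -/

/-- Outside of the cone `‖h_{Tᶜ}‖₁ ≤ 4 ‖h_T‖₁` the error `h` is controlled by the bias `A`. -/
theorem oracle_off_cone {q : (Fin p → ℝ) → ℝ} (hq : ∀ v, 0 ≤ q v) (h0 : q 0 = 0)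
    (hneg : ∀ v, q (-v) = q v)
    (hadd : ∀ u v, q (u + v) ≤ q u + q v) {s₀ k : ℕ} (hk : 0 < k) (hks : k ≤ s₀) (hsp : s₀ ≤ p)
    {L K μ A : ℝ} (hL : 0 ≤ L) (hK : 1 ≤ K) (hμ : 0 < μ) (hA0 : 0 ≤ A)
    (hRE : ∀ (J : Finset (Fin p)) (v : Fin p → ℝ), J.card ≤ s₀ → l1On Jᶜ v ≤ 4 * l1On J v →
      l2On J v ≤ K * q v)
    (hsparse : ∀ v : Fin p → ℝ, ({j | v j ≠ 0} : Finset (Fin p)).card ≤ k →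
      q v ≤ L * l2On Finset.univ v)
    (hA : A ≤ μ * √k / 5) (hLA : L * A ≤ μ * √k / 5)
    {T : Finset (Fin p)} (hT : T.card ≤ k) {h : Fin p → ℝ}
    (hbasic : 3 / 4 * q h ^ 2 + μ * l1On Tᶜ h ≤
      μ * l1On T h + A * q h + μ / 2 * (l1On T h + l1On Tᶜ h))
    (hcone : 4 * l1On T h < l1On Tᶜ h) :
    l1On Tᶜ h ≤ μ * k / 8 ∧ l2On T h ≤ K * (μ * √k) := by
  have hx := hq h
  have hk' : (0 : ℝ) < k := by exact_mod_cast hk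
  have hsk : 0 < √(k : ℝ) := Real.sqrt_pos.mpr hk'
  have hTn := l1On_nonneg T h
  -- Off the cone `3μ‖h_T‖₁ < (3/4)μ‖h_{Tᶜ}‖₁` is absorbed on the left, leaving only the bias on the
  -- right.
  have hkey : 3 / 2 * q h ^ 2 + μ / 4 * l1On Tᶜ h ≤ 2 * A * q h := by nlinarith
  have hcn := l1On_nonneg Tᶜ h
  have hxA : q h ≤ 4 / 3 * A := by
    by_contra hlt
    push Not at hlt
    have : 0 ≤ μ / 4 * l1On Tᶜ h := by positivity
    nlinarith
  have hc : μ * l1On Tᶜ h ≤ 8 / 3 * A ^ 2 := by nlinarith [sq_nonneg (3 * q h - 2 * A)]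
  have hA2 : A ^ 2 ≤ μ ^ 2 * k / 25 := by
    have := pow_le_pow_left₀ hA0 hA 2
    rw [div_pow, mul_pow, Real.sq_sqrt hk'.le] at this
    linarith
  constructor
  · have : μ * l1On Tᶜ h ≤ μ * (μ * k / 8) := by nlinarith [mul_pos (pow_pos hμ 2) hk']
    exact le_of_mul_le_mul_left this hμ
  -- `T` is replaced by the `k` largest entries of `h`: the restriction to `J` lies trivially in the
  -- cone, and the remainder can be shelled.
  · obtain ⟨J, hJ, hlarge⟩ := exists_card_eq_forall_le (fun j => |h j|) (hks.trans hsp)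
    have hTJ : l2On T h ≤ l2On J h := by
      apply Real.sqrt_le_sqrt
      refine sum_le_sum_of_largest (f := fun j => h j ^ 2) (fun _ => sq_nonneg _) ?_
        (hT.trans hJ.ge) (hJ ▸ hk)
      exact fun j hj l hl => sq_le_sq.mpr (hlarge j hj l hl)
    have hshell := shelling_bound h0 hadd hL hk (hks.trans hsp) hsparse _ h le_rfl J hJ hlarge
    have hJre : l2On J h ≤ K * q (restrictTo J h) := by
      rw [← l2On_self_restrictTo]
      refine hRE J _ (hJ.le.trans hks) ?_
      rw [l1On_compl_restrictTo]
      exact mul_nonneg (by norm_num) (l1On_nonneg _ _)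
    have hqJ : q (restrictTo J h) ≤ q h + q (restrictTo Jᶜ h) := by
      have e : restrictTo J h = h + -restrictTo Jᶜ h := by
        conv_rhs => rw [← restrictTo_add_compl J h]
        abel_nf
        ext j
        by_cases hj : j ∈ J <;> simp [restrictTo, hj]
      calc q (restrictTo J h) = q (h + -restrictTo Jᶜ h) := by rw [← e]
        _ ≤ q h + q (restrictTo Jᶜ h) := (hadd _ _).trans_eq (by rw [hneg])
    have htot : l1On Finset.univ h ≤ 5 / 4 * l1On Tᶜ h := by
      rw [← l1On_add_compl T h]
      linarith
    have htail : L * (l1On Finset.univ h / √k) ≤ A := by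
      rw [mul_div_assoc', div_le_iff₀ hsk]
      have h1 : μ * (L * l1On Finset.univ h) ≤ μ * (A * √k) := by
        have h2 : μ * l1On Finset.univ h ≤ 10 / 3 * A ^ 2 := by nlinarith
        calc μ * (L * l1On Finset.univ h) = L * (μ * l1On Finset.univ h) := by ring
          _ ≤ L * (10 / 3 * A ^ 2) := by gcongr
          _ = 10 / 3 * A * (L * A) := by ring
          _ ≤ 10 / 3 * A * (μ * √k / 5) := by gcongr
          _ ≤ μ * (A * √k) := by nlinarith [mul_nonneg (mul_nonneg hA0 hμ.le) hsk.le]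
      exact le_of_mul_le_mul_left h1 hμ
    refine hTJ.trans (hJre.trans ?_)
    gcongr
    nlinarith [mul_pos hμ hsk]

/-- On the cone, `‖h_T‖₁ ≤ √k K q(h)` reduces everything to a quadratic inequality in `q(h)`; off
the cone, `oracle_off_cone` gives stronger constants. -/
theorem oracle_inequality {q : (Fin p → ℝ) → ℝ} (hq : ∀ v, 0 ≤ q v) (h0 : q 0 = 0)
    (hneg : ∀ v, q (-v) = q v)
    (hadd : ∀ u v, q (u + v) ≤ q u + q v) {s₀ k : ℕ} (hks : k ≤ s₀) (hsp : s₀ ≤ p)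
    {L K μ A : ℝ} (hL : 0 ≤ L) (hK : 1 ≤ K) (hμ : 0 < μ) (hA0 : 0 ≤ A)
    (hRE : ∀ (J : Finset (Fin p)) (v : Fin p → ℝ), J.card ≤ s₀ → l1On Jᶜ v ≤ 4 * l1On J v →
      l2On J v ≤ K * q v)
    (hsparse : ∀ v : Fin p → ℝ, ({j | v j ≠ 0} : Finset (Fin p)).card ≤ k →
      q v ≤ L * l2On Finset.univ v)
    (hA : A ≤ μ * √k / 5) (hLA : L * A ≤ μ * √k / 5)
    {T : Finset (Fin p)} (hT : T.card ≤ k) {h : Fin p → ℝ}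
    (hbasic : 3 / 4 * q h ^ 2 + μ * l1On Tᶜ h ≤
      μ * l1On T h + A * q h + μ / 2 * (l1On T h + l1On Tᶜ h)) :
    l1On Tᶜ h ≤ 9 / 4 * K ^ 2 * (μ * k) ∧ l2On T h ≤ 4 * K ^ 2 * (μ * √k) := by
  have hk' : (0 : ℝ) ≤ k := Nat.cast_nonneg k
  have hsk : 0 ≤ √(k : ℝ) := Real.sqrt_nonneg _
  have hx := hq h
  by_cases hcone : l1On Tᶜ h ≤ 4 * l1On T h
  · have hre := hRE T h (hT.trans hks) hcone
    have h1 := l1On_le_sqrt_mul_l2On hT h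
    have hcn := l1On_nonneg Tᶜ h
    set m := μ * √(k : ℝ) with hm
    have hm0 : 0 ≤ m := by positivity
    have hmm : m ^ 2 = μ * (μ * k) := by
      rw [hm, mul_pow, Real.sq_sqrt hk']
      ring
    have hT1 : μ * l1On T h ≤ K * m * q h := by
      calc μ * l1On T h ≤ μ * (√k * (K * q h)) := by gcongr; exact h1.trans (by gcongr)
        _ = K * m * q h := by rw [hm]; ring
    have hAq : A * q h ≤ K * m / 5 * q h := by
      gcongr
      nlinarith
    -- `17/5 = 3 + 2/5`: penalty with noise, then bias. Maximising over `q h` yields `(17/5)²/6 <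
    -- 9/4`.
    have hkey : 3 / 2 * q h ^ 2 + μ * l1On Tᶜ h ≤ 17 / 5 * (K * m) * q h := by nlinarith
    have hKm : 0 ≤ K * m := by positivity
    constructor
    · have h2 : μ * l1On Tᶜ h ≤ μ * (9 / 4 * K ^ 2 * (μ * k)) := by
        have e : μ * (9 / 4 * K ^ 2 * (μ * k)) = 9 / 4 * (K * m) ^ 2 := by
          rw [mul_pow, hmm]
          ring
        rw [e]
        nlinarith [sq_nonneg (q h - 17 / 15 * (K * m)), sq_nonneg (K * m)]
      exact le_of_mul_le_mul_left h2 hμ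
    · have hxB : q h ≤ 4 * (K * m) := by
        by_contra hlt
        push Not at hlt
        have : 0 ≤ μ * l1On Tᶜ h := by positivity
        nlinarith
      calc l2On T h ≤ K * (4 * (K * m)) := hre.trans (by gcongr)
        _ = 4 * K ^ 2 * m := by ring
  · push Not at hcone
    have hK2 : 1 ≤ K ^ 2 := one_le_pow₀ hK
    -- For `k = 0` there is neither support nor bias, so the basic inequality forces `h` to vanish
    -- in `ℓ₁`.
    rcases Nat.eq_zero_or_pos k with rfl | hkpos
    · have hTe : T = ∅ := Finset.card_eq_zero.mp (Nat.le_zero.mp hT)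
      have hAz : A = 0 := le_antisymm (by simpa using hA) hA0
      subst hTe hAz
      simp only [l1On, l2On, Finset.sum_empty] at hbasic ⊢
      simp only [Nat.cast_zero, Real.sqrt_zero, mul_zero, le_refl, and_true]
      nlinarith [sq_nonneg (q h)]
    · obtain ⟨ha, hb⟩ := oracle_off_cone hq h0 hneg hadd hkpos hks hsp hL hK hμ hA0 hRE hsparse
        hA hLA hT hbasic hcone
      constructor
      · have : 0 ≤ μ * k := by positivity
        nlinarith
      · have : 0 ≤ μ * √k := by positivity
        refine hb.trans ?_
        gcongr
        nlinarith

/-! ### The basic inequality of the Lasso -/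

theorem sum_erase_mul_eq_mulVec (X : Matrix (Fin n) (Fin p) ℝ) {i : Fin p} {v : Fin p → ℝ}
    (hv : v i = 0) (r : Fin n) : ∑ j ∈ Finset.univ.erase i, v j * X r j = (X *ᵥ v) r := by
  rw [Finset.sum_erase _ (by simp [hv])]
  exact Finset.sum_congr rfl fun _ _ => mul_comm _ _

theorem sum_erase_abs_eq_l1On {i : Fin p} {v : Fin p → ℝ} (hv : v i = 0) :
    ∑ j ∈ Finset.univ.erase i, |v j| = l1On Finset.univ v :=
  Finset.sum_erase _ (by simp [hv])

theorem lassoObjective_eq (X : Matrix (Fin n) (Fin p) ℝ) {i : Fin p} (μ : ℝ) {v : Fin p → ℝ}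
    (hv : v i = 0) : lassoObjective X i μ v =
      1 / (2 * n) * ∑ r, (X r i - (X *ᵥ v) r) ^ 2 + μ * l1On Finset.univ v := by
  simp only [lassoObjective, sum_erase_mul_eq_mulVec X hv, sum_erase_abs_eq_l1On hv]

/-- The `i`-th entry of a minimiser is arbitrary; this permits setting it to zero. -/
theorem lassoObjective_update (X : Matrix (Fin n) (Fin p) ℝ) (i : Fin p) (μ : ℝ)
    (v : Fin p → ℝ) :
    lassoObjective X i μ (Function.update v i 0) = lassoObjective X i μ v := by
  have h : ∀ j ∈ Finset.univ.erase i, Function.update v i 0 j = v j := fun j hj =>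
    Function.update_of_ne (Finset.ne_of_mem_erase hj) _ _
  have h1 : ∑ j ∈ Finset.univ.erase i, |Function.update v i 0 j| =
      ∑ j ∈ Finset.univ.erase i, |v j| :=
    Finset.sum_congr rfl fun j hj => by rw [h j hj]
  have h2 : ∀ r, ∑ j ∈ Finset.univ.erase i, Function.update v i 0 j * X r j =
      ∑ j ∈ Finset.univ.erase i, v j * X r j := fun r =>
    Finset.sum_congr rfl fun j hj => by rw [h j hj]
  simp only [lassoObjective, h1, h2]

/-- Comparing a Lasso solution `b` with the midpoint of `b` and `u`. -/
theorem lasso_midpoint_inequality {X : Matrix (Fin n) (Fin p) ℝ} {i : Fin p} {μ : ℝ} (hμ : 0 ≤ μ)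
    {b u : Fin p → ℝ} (hb : IsLassoSolution X i μ b) (hbi : b i = 0) (hui : u i = 0) :
    3 / 4 * empNorm X (b - u) ^ 2 + μ * l1On Finset.univ b ≤ μ * l1On Finset.univ u +
      1 / n * ∑ r, (X r i - (X *ᵥ u) r) * (X *ᵥ (b - u)) r := by
  -- The midpoint yields `3/4` in front of the squared prediction error, where comparison with `u`
  -- itself would yield only `1/2`, too little for the constant `9/4` required by `D₁`.
  have h := hb ((1 / 2 : ℝ) • (b + u))
  rw [lassoObjective_eq X μ hbi, lassoObjective_eq X μ (by simp [hbi, hui])] at h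
  have hl1 : l1On Finset.univ ((1 / 2 : ℝ) • (b + u)) ≤
      1 / 2 * (l1On Finset.univ b + l1On Finset.univ u) := by
    simp only [l1On, ← Finset.sum_add_distrib, Finset.mul_sum]
    refine Finset.sum_le_sum fun j _ => ?_
    simp only [Pi.smul_apply, Pi.add_apply, smul_eq_mul, abs_mul]
    rw [abs_of_pos (by norm_num : (0 : ℝ) < 1 / 2)]
    gcongr
    exact abs_add_le _ _
  have hl2 : 1 / (2 * n : ℝ) * ∑ r, (X r i - (X *ᵥ b) r) ^ 2 -
      1 / (2 * n : ℝ) * ∑ r, (X r i - (X *ᵥ ((1 / 2 : ℝ) • (b + u))) r) ^ 2 =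
      3 / 8 * empNorm X (b - u) ^ 2 -
        1 / 2 * (1 / n * ∑ r, (X r i - (X *ᵥ u) r) * (X *ᵥ (b - u)) r) := by
    rw [empNorm_sq]
    have e : (1 : ℝ) / (2 * n) = 1 / 2 * (1 / n) := by rw [div_mul_div_comm, one_mul]
    rw [e]
    simp only [Finset.mul_sum, ← Finset.sum_sub_distrib]
    refine Finset.sum_congr rfl fun r _ => ?_
    simp only [Matrix.mulVec_smul, Matrix.mulVec_add, Matrix.mulVec_sub, Pi.smul_apply,
      Pi.add_apply, Pi.sub_apply, smul_eq_mul]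
    ring
  have hl1' := mul_le_mul_of_nonneg_left hl1 hμ
  linarith

/-- The basic inequality for the Lasso with support set `T`, bias `δ` and noise `e`. -/
theorem lasso_basic_inequality {X : Matrix (Fin n) (Fin p) ℝ} {i : Fin p} {μ : ℝ} (hμ : 0 ≤ μ)
    {b β : Fin p → ℝ} (hb : IsLassoSolution X i μ b) (hbi : b i = 0) (hβi : β i = 0)
    (hnoise : ∀ k, k ≠ i → |1 / n * ∑ r, (X r i - (X *ᵥ β) r) * X r k| ≤ μ / 2)
    (T : Finset (Fin p)) :
    3 / 4 * empNorm X (b - restrictTo T β) ^ 2 + μ * l1On Tᶜ (b - restrictTo T β) ≤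
      μ * l1On T (b - restrictTo T β) +
      empNorm X (restrictTo Tᶜ β) * empNorm X (b - restrictTo T β) +
      μ / 2 * (l1On T (b - restrictTo T β) + l1On Tᶜ (b - restrictTo T β)) := by
  set u := restrictTo T β with hu
  set δ := restrictTo Tᶜ β with hδ
  set h := b - u with hh
  have hui : u i = 0 := by simp [hu, restrictTo, hβi]
  have hhi : h i = 0 := by simp [hh, hbi, hui]
  have hmid := lasso_midpoint_inequality hμ hb hbi hui
  rw [← hh] at hmid
  -- The residual at `u` is the bias `Xδ` plus the regression noise; Cauchy–Schwarz handles the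
  -- first and `hnoise` the second.
  have hsplit : 1 / n * ∑ r, (X r i - (X *ᵥ u) r) * (X *ᵥ h) r =
      1 / n * ∑ r, (X *ᵥ δ) r * (X *ᵥ h) r +
        1 / n * ∑ r, (X r i - (X *ᵥ β) r) * (X *ᵥ h) r := by
    rw [← mul_add, ← Finset.sum_add_distrib]
    congr 1
    refine Finset.sum_congr rfl fun r _ => ?_
    have : (X *ᵥ β) r = (X *ᵥ u) r + (X *ᵥ δ) r := by
      rw [← restrictTo_add_compl T β, Matrix.mulVec_add, Pi.add_apply]
    rw [this]
    ring
  have hbias := inner_le_empNorm_mul X δ h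
  have hnoise' : 1 / n * ∑ r, (X r i - (X *ᵥ β) r) * (X *ᵥ h) r ≤
      μ / 2 * l1On Finset.univ h := by
    have e : 1 / n * ∑ r, (X r i - (X *ᵥ β) r) * (X *ᵥ h) r =
        ∑ k, h k * (1 / n * ∑ r, (X r i - (X *ᵥ β) r) * X r k) := by
      conv_lhs => simp only [Matrix.mulVec, dotProduct]
      simp only [Finset.mul_sum]
      rw [Finset.sum_comm]
      refine Finset.sum_congr rfl fun k _ => Finset.sum_congr rfl fun r _ => ?_
      simp only [Matrix.mulVec, dotProduct]
      ring
    rw [e, l1On, Finset.mul_sum]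
    refine Finset.sum_le_sum fun k _ => ?_
    rcases eq_or_ne k i with rfl | hki
    · simp [hhi]
    · calc h k * (1 / n * ∑ r, (X r i - (X *ᵥ β) r) * X r k)
          ≤ |h k| * |1 / n * ∑ r, (X r i - (X *ᵥ β) r) * X r k| := by
            rw [← abs_mul]
            exact le_abs_self _
        _ ≤ |h k| * (μ / 2) := by gcongr; exact hnoise k hki
        _ = μ / 2 * |h k| := mul_comm _ _
  have hpen : l1On Finset.univ u - l1On Finset.univ b ≤ l1On T h - l1On Tᶜ h := by
    rw [← l1On_add_compl T b, hu, l1On_restrictTo]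
    have hTc : l1On Tᶜ h = l1On Tᶜ b := Finset.sum_congr rfl fun j hj => by
      simp [hh, hu, restrictTo, Finset.mem_compl.mp hj]
    have hT : l1On T β ≤ l1On T b + l1On T h := by
      simp only [l1On, ← Finset.sum_add_distrib]
      refine Finset.sum_le_sum fun j hj => ?_
      simp only [hh, hu, restrictTo, hj, if_true, Pi.sub_apply]
      have := abs_sub_abs_le_abs_sub (β j) (b j)
      rw [abs_sub_comm] at this
      linarith
    linarith
  have hpen' := mul_le_mul_of_nonneg_left hpen hμ
  rw [← l1On_add_compl T h] at hnoise'
  linarith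

/-! ### Concentration matrix and regression coefficients -/

/-- With `w = Σ⁻¹e_i` and `t = w_i`, the quadratic form of `Σ` at `e_i - w/t` equals `1 - 1/t`,
which must be nonnegative. -/
theorem one_le_inv_diag {S : Matrix (Fin p) (Fin p) ℝ} (hS : S.PosDef) (hSdiag : ∀ i, S i i = 1)
    (i : Fin p) : 1 ≤ S⁻¹ i i := by
  have hpos : 0 < S⁻¹ i i := hS.inv.diag_pos
  set t := S⁻¹ i i with ht
  have hunit : IsUnit S.det := hS.isUnit.map Matrix.detMonoidHom
  set w : Fin p → ℝ := S⁻¹ *ᵥ Pi.single i 1 with hw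
  have hSw : S *ᵥ w = Pi.single i 1 := by
    rw [hw, Matrix.mulVec_mulVec, Matrix.mul_nonsing_inv _ hunit, Matrix.one_mulVec]
  have hwi : w i = t := by simp [hw, ht]
  have hsymm : w ⬝ᵥ S *ᵥ Pi.single i 1 = (S *ᵥ w) ⬝ᵥ Pi.single i 1 := by
    have hT : Sᵀ = S := by simpa using hS.isHermitian.eq
    rw [Matrix.dotProduct_mulVec, ← Matrix.mulVec_transpose, hT]
  have hnn := hS.posSemidef.dotProduct_mulVec_nonneg (Pi.single i 1 - t⁻¹ • w)
  rw [star_trivial, Matrix.mulVec_sub, Matrix.mulVec_smul, hSw, sub_dotProduct, dotProduct_sub,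
    dotProduct_sub, smul_dotProduct, smul_dotProduct, hsymm, hSw] at hnn
  simp [hSdiag, hwi, hpos.ne'] at hnn
  exact (inv_le_one₀ hpos).mp hnn

theorem regCoef_self (Θ : Matrix (Fin p) (Fin p) ℝ) (i : Fin p) : regCoef Θ i i = 0 := by
  simp [regCoef]

theorem noise_eq (Θ : Matrix (Fin p) (Fin p) ℝ) (X : Matrix (Fin n) (Fin p) ℝ) (i : Fin p)
    (r : Fin n) : noise Θ X i r = X r i - (X *ᵥ regCoef Θ i) r := by
  rw [noise, sum_erase_mul_eq_mulVec X (regCoef_self Θ i)]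

theorem noiseSd_pos {Θ : Matrix (Fin p) (Fin p) ℝ} {i : Fin p} (h : 1 ≤ Θ i i) :
    0 < noiseSd Θ i :=
  Real.sqrt_pos.mpr (by positivity)

theorem noiseSd_le_one {Θ : Matrix (Fin p) (Fin p) ℝ} {i : Fin p} (h : 1 ≤ Θ i i) :
    noiseSd Θ i ≤ 1 := by
  rw [noiseSd, Real.sqrt_le_one]
  exact (div_le_one (by positivity)).mpr h

theorem lam_pos (hn : 1 ≤ n) (hp : 2 ≤ p) : 0 < lam n p := by
  have hlog : 0 < Real.log p := Real.log_pos (by exact_mod_cast hp)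
  have : (0 : ℝ) < n := by exact_mod_cast hn
  exact Real.sqrt_pos.mpr (by positivity)

theorem abs_noise_inner_le {Θ : Matrix (Fin p) (Fin p) ℝ} {a : ℝ} {X : Matrix (Fin n) (Fin p) ℝ}
    (h : EventC Θ a X) {i : Fin p} (hΘ : 1 ≤ Θ i i) {k : Fin p} (hk : k ≠ i) :
    |1 / n * ∑ r, (X r i - (X *ᵥ regCoef Θ i) r) * X r k| ≤ √(1 + a) * lam n p := by
  have hσ := noiseSd_pos hΘ
  have e : 1 / n * ∑ r, (X r i - (X *ᵥ regCoef Θ i) r) * X r k =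
      noiseSd Θ i * (1 / n * ∑ r, noise Θ X i r / noiseSd Θ i * X r k) := by
    simp only [Finset.mul_sum, noise_eq]
    refine Finset.sum_congr rfl fun r _ => ?_
    field_simp
  rw [e, abs_mul, abs_of_pos hσ]
  calc noiseSd Θ i * |1 / n * ∑ r, noise Θ X i r / noiseSd Θ i * X r k|
      ≤ 1 * |1 / n * ∑ r, noise Θ X i r / noiseSd Θ i * X r k| := by
        gcongr
        exact noiseSd_le_one hΘ
    _ ≤ √(1 + a) * lam n p := by
        rw [one_mul]
        exact (h i k hk).le

/-- The infimum over naturals is attained since the set is nonempty; the index `i` may be included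
in the sum because its coefficient is set to zero. -/
theorem essSparsity_spec (hlam : 0 < lam n p) {Θ : Matrix (Fin p) (Fin p) ℝ} {i : Fin p}
    (hΘ : 1 ≤ Θ i i) :
    ∑ j, min (regCoef Θ i j ^ 2) (lam n p ^ 2 * noiseSd Θ i ^ 2) ≤
      essSparsity n Θ i * (lam n p ^ 2 * noiseSd Θ i ^ 2) := by
  have hc : 0 < lam n p ^ 2 * noiseSd Θ i ^ 2 := by
    have := noiseSd_pos hΘ
    positivity
  have hne : {k : ℕ | ∑ j ∈ Finset.univ.erase i,
      min (regCoef Θ i j ^ 2) (lam n p ^ 2 * noiseSd Θ i ^ 2)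
    ≤ k * (lam n p ^ 2 * noiseSd Θ i ^ 2)}.Nonempty := by
    obtain ⟨k, hk⟩ := exists_nat_ge ((∑ j ∈ Finset.univ.erase i,
      min (regCoef Θ i j ^ 2) (lam n p ^ 2 * noiseSd Θ i ^ 2)) /
        (lam n p ^ 2 * noiseSd Θ i ^ 2))
    exact ⟨k, (div_le_iff₀ hc).mp hk⟩
  have h : ∑ j ∈ Finset.univ.erase i,
      min (regCoef Θ i j ^ 2) (lam n p ^ 2 * noiseSd Θ i ^ 2) ≤
        essSparsity n Θ i * (lam n p ^ 2 * noiseSd Θ i ^ 2) := Nat.sInf_mem hne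
  rwa [Finset.sum_erase _ (by simp [regCoef_self, hc.le])] at h

/-- The indices of the coefficients of size at least `λ σ_{V_i}`. -/
noncomputable def largeCoefs (n : ℕ) (Θ : Matrix (Fin p) (Fin p) ℝ) (i : Fin p) : Finset (Fin p) :=
  {j | lam n p * noiseSd Θ i ≤ |regCoef Θ i j|}

theorem mem_largeCoefs_iff (hlam : 0 < lam n p) {Θ : Matrix (Fin p) (Fin p) ℝ} {i : Fin p}
    (hΘ : 1 ≤ Θ i i) {j : Fin p} :
    j ∈ largeCoefs n Θ i ↔ lam n p ^ 2 * noiseSd Θ i ^ 2 ≤ regCoef Θ i j ^ 2 := by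
  have hσ := noiseSd_pos hΘ
  rw [← mul_pow, sq_le_sq, abs_of_pos (mul_pos hlam hσ)]
  simp [largeCoefs]

/-- Each large coefficient contributes a full `λ²σ²` to the sum defining the essential sparsity. -/
theorem card_largeCoefs_le (hlam : 0 < lam n p) {Θ : Matrix (Fin p) (Fin p) ℝ} {i : Fin p}
    (hΘ : 1 ≤ Θ i i) : (largeCoefs n Θ i).card ≤ essSparsity n Θ i := by
  have hσ := noiseSd_pos hΘ
  have hc : 0 < lam n p ^ 2 * noiseSd Θ i ^ 2 := by positivity
  have h1 := Finset.card_nsmul_le_sum (largeCoefs n Θ i)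
    (fun j => min (regCoef Θ i j ^ 2) (lam n p ^ 2 * noiseSd Θ i ^ 2)) _
    (fun j hj => le_min ((mem_largeCoefs_iff hlam hΘ).mp hj) le_rfl)
  have h2 := Finset.sum_le_sum_of_subset_of_nonneg (Finset.subset_univ (largeCoefs n Θ i))
    (f := fun j => min (regCoef Θ i j ^ 2) (lam n p ^ 2 * noiseSd Θ i ^ 2))
    (fun j _ _ => le_min (sq_nonneg _) hc.le)
  rw [nsmul_eq_mul] at h1
  have h3 := (h1.trans h2).trans (essSparsity_spec hlam hΘ)
  exact_mod_cast le_of_mul_le_mul_right h3 hc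

/-- For a small coefficient the minimum is its square, and `σ ≤ 1`. -/
theorem sum_compl_largeCoefs_le (hlam : 0 < lam n p) {Θ : Matrix (Fin p) (Fin p) ℝ} {i : Fin p}
    (hΘ : 1 ≤ Θ i i) : ∑ j ∈ (largeCoefs n Θ i)ᶜ, regCoef Θ i j ^ 2 ≤
      essSparsity n Θ i * lam n p ^ 2 := by
  have hσ := noiseSd_pos hΘ
  have hc : 0 < lam n p ^ 2 * noiseSd Θ i ^ 2 := by positivity
  have h1 : ∑ j ∈ (largeCoefs n Θ i)ᶜ, regCoef Θ i j ^ 2 =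
      ∑ j ∈ (largeCoefs n Θ i)ᶜ, min (regCoef Θ i j ^ 2) (lam n p ^ 2 * noiseSd Θ i ^ 2) := by
    refine Finset.sum_congr rfl fun j hj => (min_eq_left ?_).symm
    rw [Finset.mem_compl, mem_largeCoefs_iff hlam hΘ] at hj
    exact (not_le.mp hj).le
  have h2 := Finset.sum_le_sum_of_subset_of_nonneg (Finset.subset_univ (largeCoefs n Θ i)ᶜ)
    (f := fun j => min (regCoef Θ i j ^ 2) (lam n p ^ 2 * noiseSd Θ i ^ 2))
    (fun j _ _ => le_min (sq_nonneg _) hc.le)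
  rw [h1]
  refine (h2.trans (essSparsity_spec hlam hΘ)).trans ?_
  have : noiseSd Θ i ^ 2 ≤ 1 := pow_le_one₀ hσ.le (noiseSd_le_one hΘ)
  gcongr
  exact mul_le_of_le_one_right (sq_nonneg _) this

theorem apply_ne_zero_of_mem_largeCoefs (hlam : 0 < lam n p) {Θ : Matrix (Fin p) (Fin p) ℝ}
    {i j : Fin p} (hΘ : 1 ≤ Θ i i) (hj : j ∈ largeCoefs n Θ i) : Θ i j ≠ 0 := by
  intro h0
  have hz : regCoef Θ i j = 0 := by simp [regCoef, h0]
  have := mul_pos hlam (noiseSd_pos hΘ)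
  simp only [largeCoefs, Finset.mem_filter, hz, abs_zero] at hj
  linarith [hj.2]

theorem card_support_regCoef_le (Θ : Matrix (Fin p) (Fin p) ℝ) (i : Fin p) (J : Finset (Fin p)) :
    ({j | restrictTo J (regCoef Θ i) j ≠ 0} : Finset (Fin p)).card ≤ maxDegree Θ := by
  refine le_trans (Finset.card_le_card fun j hj => ?_)
    (Finset.le_sup (f := nodeDegree Θ) (Finset.mem_univ i))
  rw [Finset.mem_filter] at hj ⊢
  have h := hj.2
  refine ⟨hj.1, fun e => h ?_, fun e => h ?_⟩ <;> simp [restrictTo, regCoef, e]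

/-! ### Constants -/

/-- The last term of `D₀` suffices, since `4 ≤ 3√2`. -/
theorem four_mul_sq_le_constD0 {S : Matrix (Fin p) (Fin p) ℝ} {c₀ θ : ℝ} (hθ0 : 0 < θ)
    (hθ1 : θ < 1) (hd : 0 ≤ d0 n S c₀ θ)
    (hK : 0 ≤ reK (maxEssSparsity n S⁻¹) 4 (popNorm S)) :
    4 * (reK (maxEssSparsity n S⁻¹) 4 (popNorm S) / (1 - θ)) ^ 2 ≤ constD0 n S c₀ θ := by
  refine le_trans ?_ (le_max_right _ _)
  have h1 : 0 < 1 - θ := by linarith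
  have h2 : 4 ≤ 3 * √2 := by
    nlinarith [Real.sq_sqrt (show (0 : ℝ) ≤ 2 by norm_num), Real.sqrt_nonneg 2]
  have h3 : 4 * (reK (maxEssSparsity n S⁻¹) 4 (popNorm S) / (1 - θ)) ^ 2 ≤
      3 * √2 * reK (maxEssSparsity n S⁻¹) 4 (popNorm S) ^ 2 / (1 - θ) ^ 2 := by
    rw [div_pow, ← mul_div_assoc]
    gcongr
  exact h3.trans (le_add_of_nonneg_left (by positivity))

theorem nine_fourths_mul_sq_le_constD1 {S : Matrix (Fin p) (Fin p) ℝ} {c₀ θ : ℝ} (hθ0 : 0 < θ)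
    (hθ1 : θ < 1) (hd : 0 ≤ d0 n S c₀ θ)
    (hK : 0 ≤ reK (maxEssSparsity n S⁻¹) 4 (popNorm S)) :
    9 / 4 * (reK (maxEssSparsity n S⁻¹) 4 (popNorm S) / (1 - θ)) ^ 2 ≤ constD1 n S c₀ θ := by
  refine le_trans ?_ (le_max_right _ _)
  have h1 : 0 < 1 - θ := by linarith
  have e : 9 / 4 * (reK (maxEssSparsity n S⁻¹) 4 (popNorm S) / (1 - θ)) ^ 2 =
      (3 * reK (maxEssSparsity n S⁻¹) 4 (popNorm S) / (2 * (1 - θ))) ^ 2 := by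
    field_simp
    ring
  rw [e]
  gcongr
  exact le_add_of_nonneg_left (by positivity)

/-! ### The nodewise Lasso -/

/-- Instance of `oracle_inequality` with `L = (1+θ)√ρ_max(3s₀)` and `K/(1-θ)` as restricted
eigenvalue constant. -/
theorem nodewise_lasso_bounds (hn : 1 ≤ n) {S : Matrix (Fin p) (Fin p) ℝ} (hS : S.PosDef)
    (hSdiag : ∀ i, S i i = 1) (hRE : RE (maxEssSparsity n S⁻¹) 4 (popNorm S))
    (hs : 1 ≤ maxDegree S⁻¹) {θ a c₀ : ℝ} (hθ0 : 0 < θ) (hθ1 : θ < 1)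
    (hc₀ : 4 * √2 ≤ c₀) (hd₀ : 2 * (1 + θ) * √(1 + a) ≤ d0 n S c₀ θ)
    (hd₀pos : 0 < d0 n S c₀ θ)
    {X : Matrix (Fin n) (Fin p) ℝ} (hC : EventC S⁻¹ a X) (hX : EventX S θ X) {i : Fin p}
    {b : Fin p → ℝ} (hb : IsLassoSolution X i (d0 n S c₀ θ * lam n p) b) (hbi : b i = 0) :
    l1On (largeCoefs n S⁻¹ i)ᶜ b ≤
        constD1 n S c₀ θ * (d0 n S c₀ θ * lam n p * essSparsity n S⁻¹ i) ∧
      l2On (largeCoefs n S⁻¹ i) (b - regCoef S⁻¹ i) ≤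
        constD0 n S c₀ θ * (d0 n S c₀ θ * lam n p * √(essSparsity n S⁻¹ i)) := by
  set s₀ := maxEssSparsity n S⁻¹ with hs₀
  set s := maxDegree S⁻¹ with hsdef
  set k := essSparsity n S⁻¹ i with hk
  set d := d0 n S c₀ θ with hd
  set T := largeCoefs n S⁻¹ i with hT
  set β := regCoef S⁻¹ i with hβ
  set K := reK s₀ 4 (popNorm S) with hKdef
  have hs₀1 : 1 ≤ s₀ := hRE.1
  have hs₀p : s₀ < p := hRE.2.1
  have hlam : 0 < lam n p := lam_pos hn (by omega)
  have hΘ : 1 ≤ S⁻¹ i i := one_le_inv_diag hS hSdiag i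
  have hθ' : 0 < 1 - θ := by linarith
  have hK1 : 1 ≤ K := one_le_reK_popNorm hSdiag hRE
  have hK'1 : 1 ≤ K / (1 - θ) := (one_le_div hθ').mpr (by linarith)
  obtain ⟨⟨hREX, -, hKX⟩, -, hM⟩ := hX
  have hks : k ≤ s₀ := Finset.le_sup (f := essSparsity n S⁻¹) (Finset.mem_univ i)
  have hMs := (hM s hs (le_max_left _ _)).2.2.2
  have hM3 := (hM (3 * s₀) (by omega) (by
    refine le_trans ?_ (le_max_right _ _)
    push_cast
    gcongr
    norm_num)).2.2.2
  set ρs := sparseMax (popNorm S) s with hρs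
  set ρ3 := sparseMax (popNorm S) (3 * s₀) with hρ3
  have hρ3one : 1 ≤ ρ3 := one_le_sparseMax_popNorm hS hSdiag i (by omega)
  have hρsone : 1 ≤ ρs := one_le_sparseMax_popNorm hS hSdiag i hs
  -- Since `c₀ ≥ 4√2 > 5`, the product form of `d₀` pays for both the shelling factor and the bias
  -- factor; this is the source of the `1/5` in the oracle inequality.
  have hd5 : 5 * ((1 + θ) * √ρ3 * ((1 + θ) * √ρs)) ≤ d := by
    have h5 : 5 ≤ c₀ := by
      nlinarith [Real.sq_sqrt (show (0 : ℝ) ≤ 2 by norm_num), Real.sqrt_nonneg 2]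
    have e : d = c₀ * ((1 + θ) * √ρ3 * ((1 + θ) * √ρs)) := by
      rw [hd, d0, ← hsdef, ← hs₀, ← hρs, ← hρ3, Real.sqrt_mul (by linarith)]
      ring
    rw [e]
    gcongr
  set A := empNorm X (restrictTo Tᶜ β) with hA
  have hδ : l2On Finset.univ (restrictTo Tᶜ β) ≤ √k * lam n p := by
    rw [l2On_restrictTo, l2On]
    apply Real.sqrt_le_iff.mpr
    refine ⟨by positivity, ?_⟩
    rw [mul_pow, Real.sq_sqrt (Nat.cast_nonneg k)]
    exact sum_compl_largeCoefs_le hlam hΘ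
  have hAle : A ≤ (1 + θ) * √ρs * (√k * lam n p) :=
    (le_sqrt_sparseMax_mul (bddAbove_sparseRatios_empNorm X s) (empNorm_zero X)
      (card_support_regCoef_le S⁻¹ i Tᶜ)).trans
      (mul_le_mul hMs hδ (l2On_nonneg _ _) (by positivity))
  set L := (1 + θ) * √ρ3 with hL
  -- With `L ≥ 1` the bound on `L * A` also bounds `A`.
  have hL1 : 1 ≤ L := by
    have : 1 ≤ √ρ3 := Real.one_le_sqrt.mpr hρ3one
    nlinarith
  have hA0 : 0 ≤ A := empNorm_nonneg _ _
  have hLA : L * A ≤ d * lam n p * √k / 5 := by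
    calc L * A ≤ L * ((1 + θ) * √ρs * (√k * lam n p)) := by gcongr
      _ = 5 * (L * ((1 + θ) * √ρs)) * (lam n p * √k) / 5 := by ring
      _ ≤ d * (lam n p * √k) / 5 := by gcongr
      _ = d * lam n p * √k / 5 := by ring
  have hAA : A ≤ d * lam n p * √k / 5 := by
    refine le_trans ?_ hLA
    nlinarith
  have hμ : 0 < d * lam n p := mul_pos hd₀pos hlam
  have hbasic := lasso_basic_inequality hμ.le hb hbi (regCoef_self S⁻¹ i) (fun l hl => by
    refine (abs_noise_inner_le hC hΘ hl).trans ?_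
    have : 2 * √(1 + a) ≤ d := by nlinarith [Real.sqrt_nonneg (1 + a)]
    nlinarith) T
  obtain ⟨h1, h2⟩ := oracle_inequality (empNorm_nonneg X) (empNorm_zero X) (empNorm_neg X)
    (empNorm_add_le X) hks hs₀p.le (by linarith) hK'1 hμ hA0
    (fun J v hJ hv => (l2On_le_reK_mul (empNorm_nonneg X) hREX.2.2.2 hJ hv).trans (by
      gcongr
      exact empNorm_nonneg X v))
    (fun v hv => (le_sqrt_sparseMax_mul (bddAbove_sparseRatios_empNorm X (3 * s₀))
      (empNorm_zero X) (by omega)).trans (by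
        gcongr
        exact l2On_nonneg _ _))
    hAA hLA (card_largeCoefs_le hlam hΘ) hbasic
  have e1 : l1On Tᶜ (b - restrictTo T β) = l1On Tᶜ b :=
    Finset.sum_congr rfl fun j hj => by simp [restrictTo, Finset.mem_compl.mp hj]
  have e2 : l2On T (b - restrictTo T β) = l2On T (b - β) := by
    unfold l2On
    congr 1
    exact Finset.sum_congr rfl fun j hj => by simp [restrictTo, hj]
  rw [e1] at h1
  rw [e2] at h2
  constructor
  · refine h1.trans ?_
    gcongr
    exact nine_fourths_mul_sq_le_constD1 hθ0 hθ1 hd₀pos.le (by linarith)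
  · refine h2.trans ?_
    gcongr
    exact four_mul_sq_le_constD0 hθ0 hθ1 hd₀pos.le (by linarith)

/-! ### Thresholding and the OR rule -/

/-- `E` is covered by the set of pairs `(i, j)` with `j ∈ I i` together with its transpose. -/
theorem card_le_two_mul_sum_of_or {E : Finset (Fin p × Fin p)} {I : Fin p → Finset (Fin p)}
    (hE : ∀ e ∈ E, e.2 ∈ I e.1 ∨ e.1 ∈ I e.2) : E.card ≤ 2 * ∑ i, (I i).card := by
  set F : Finset (Fin p × Fin p) := (Finset.univ.sigma I).image fun e => (e.1, e.2) with hF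
  have hcard : F.card ≤ ∑ i, (I i).card := by
    rw [← Finset.card_sigma]
    exact Finset.card_image_le (s := Finset.univ.sigma I) (f := fun e => (e.1, e.2))
  have hsub : E ⊆ F ∪ F.image Prod.swap := by
    rintro ⟨i, j⟩ he
    rw [Finset.mem_union]
    rcases hE _ he with h | h
    · exact Or.inl (by simpa [hF] using h)
    · exact Or.inr (by simpa [hF] using h)
  calc E.card ≤ (F ∪ F.image Prod.swap).card := Finset.card_le_card hsub
    _ ≤ F.card + (F.image Prod.swap).card := Finset.card_union_le _ _
    _ ≤ F.card + F.card := Nat.add_le_add_left Finset.card_image_le _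
    _ ≤ 2 * ∑ i, (I i).card := by omega

/-- The variables kept in the `i`-th regression at threshold `t`. -/
noncomputable def keptAt (B : Fin p → Fin p → ℝ) (t : ℝ) (i : Fin p) : Finset (Fin p) :=
  {j | j ≠ i ∧ t ≤ |B i j|}

theorem mem_keptAt_or_of_mem_selectedEdges {B : Fin p → Fin p → ℝ} {t : ℝ} {e : Fin p × Fin p}
    (he : e ∈ selectedEdges B t) : e.2 ∈ keptAt B t e.1 ∨ e.1 ∈ keptAt B t e.2 := by
  simp only [selectedEdges, droppedPairs, droppedAt, keptAt, Finset.mem_filter, Finset.mem_univ,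
    true_and] at he ⊢
  obtain ⟨hne, h⟩ := he
  by_contra hcon
  push Not at hcon
  exact h ⟨hne, ⟨hne.symm, hcon.1 hne.symm⟩, hne, hcon.2 hne⟩

/-- Markov's inequality; it counts the false inclusions after thresholding. -/
theorem card_mul_le_l1On {J T : Finset (Fin p)} {b : Fin p → ℝ} {t : ℝ}
    (h : ∀ j ∈ J, t ≤ |b j|) : (J \ T).card * t ≤ l1On Tᶜ b := by
  rw [← nsmul_eq_mul]
  refine (Finset.card_nsmul_le_sum (J \ T) (fun j => |b j|) t
    fun j hj => h j (Finset.mem_sdiff.mp hj).1).trans ?_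
  refine Finset.sum_le_sum_of_subset_of_nonneg (fun j hj => ?_) fun _ _ _ => abs_nonneg _
  simpa using (Finset.mem_sdiff.mp hj).2

/-- Squared error incurred by dropping the coordinates of `b` below the threshold `t`. -/
theorem sum_sq_dropped_le {b β : Fin p → ℝ} {D T : Finset (Fin p)} {t : ℝ} {k : ℕ} (ht : 0 ≤ t)
    (hD : ∀ j ∈ D, |b j| ≤ t) (hT : T.card ≤ k) :
    ∑ j ∈ D, β j ^ 2 ≤ (√k * t + l2On T (b - β)) ^ 2 + ∑ j ∈ Tᶜ, β j ^ 2 := by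
  have h1 : ∑ j ∈ D ∩ T, β j ^ 2 ≤ ∑ j ∈ T, (t + |(b - β) j|) ^ 2 := by
    refine (Finset.sum_le_sum fun j hj => ?_).trans
      (Finset.sum_le_sum_of_subset_of_nonneg Finset.inter_subset_right fun _ _ _ => sq_nonneg _)
    rw [← sq_abs (β j)]
    refine pow_le_pow_left₀ (abs_nonneg _) ?_ 2
    have e1 := hD j (Finset.mem_inter.mp hj).1
    have e2 := abs_sub_abs_le_abs_sub (β j) (b j)
    rw [abs_sub_comm] at e2
    simp only [Pi.sub_apply]
    linarith
  have h2 : ∑ j ∈ D \ T, β j ^ 2 ≤ ∑ j ∈ Tᶜ, β j ^ 2 :=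
    Finset.sum_le_sum_of_subset_of_nonneg
      (fun j hj => by simpa using (Finset.mem_sdiff.mp hj).2) fun _ _ _ => sq_nonneg _
  -- Minkowski's inequality by hand: expand, then apply Cauchy–Schwarz to the cross term.
  have h3 : ∑ j ∈ T, (t + |(b - β) j|) ^ 2 =
      T.card * t ^ 2 + 2 * t * l1On T (b - β) + l2On T (b - β) ^ 2 := by
    rw [l2On_sq, l1On, Finset.mul_sum, ← nsmul_eq_mul, ← Finset.sum_const,
      ← Finset.sum_add_distrib, ← Finset.sum_add_distrib]
    refine Finset.sum_congr rfl fun j _ => ?_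
    rw [← sq_abs ((b - β) j)]
    ring
  have h4 : T.card * t ^ 2 ≤ √k ^ 2 * t ^ 2 := by
    rw [Real.sq_sqrt (Nat.cast_nonneg k)]
    gcongr
  have h5 : 2 * t * l1On T (b - β) ≤ 2 * t * (√k * l2On T (b - β)) := by
    gcongr
    exact l1On_le_sqrt_mul_l2On hT _
  rw [← Finset.sum_inter_add_sum_sdiff D T]
  nlinarith

theorem frobenius_norm_sq (A : Matrix (Fin p) (Fin p) ℝ) : ‖A‖ ^ 2 = ∑ i, ∑ j, A i j ^ 2 := by
  have hnn : 0 ≤ ∑ i, ∑ j, A i j ^ 2 :=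
    Finset.sum_nonneg fun _ _ => Finset.sum_nonneg fun _ _ => sq_nonneg _
  rw [Matrix.frobenius_norm_def, ← Real.sqrt_eq_rpow]
  simp only [Real.rpow_two, Real.norm_eq_abs, sq_abs]
  exact Real.sq_sqrt hnn

theorem frobenius_norm_diagonal_sq (Θ : Matrix (Fin p) (Fin p) ℝ) :
    ‖Matrix.diagonal Θ.diag‖ ^ 2 = ∑ i, Θ i i ^ 2 := by
  rw [frobenius_norm_sq]
  refine Finset.sum_congr rfl fun i _ => ?_
  rw [Finset.sum_eq_single i (fun j _ hj => by simp [Matrix.diagonal_apply_ne' _ hj]) (by simp)]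
  simp

/-- Zero entries contribute nothing to either side, and a nonzero off-diagonal entry is missing from
`thetaTilde` exactly when its pair was dropped. -/
theorem thetaTilde_sub_eq (Θ : Matrix (Fin p) (Fin p) ℝ) (B : Fin p → Fin p → ℝ) (t : ℝ) :
    thetaTilde Θ (selectedEdges B t) - Θ = -restrict Θ (droppedPairs B t) := by
  ext i j
  rcases eq_or_ne i j with rfl | hij
  · simp [thetaTilde, restrict, trueEdges, droppedPairs]
  · by_cases h0 : Θ i j = 0
    · simp [thetaTilde, restrict, trueEdges, hij, h0]
    · by_cases hD : (i, j) ∈ droppedPairs B t <;>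
        simp [thetaTilde, restrict, trueEdges, selectedEdges, hij, h0, hD]

/-- Uses `θ_{ij} = -θ_{ii}β_j`; a pair dropped by the OR rule is in particular dropped from
regression `i`. -/
theorem sum_sq_restrict_row {Θ : Matrix (Fin p) (Fin p) ℝ} {i : Fin p} (hΘ : Θ i i ≠ 0)
    (B : Fin p → Fin p → ℝ) (t : ℝ) :
    ∑ j, restrict Θ (droppedPairs B t) i j ^ 2 ≤
      Θ i i ^ 2 * ∑ j ∈ droppedAt B t i, regCoef Θ i j ^ 2 := by
  rw [Finset.mul_sum, ← Finset.sum_filter_add_sum_filter_not Finset.univ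
    (fun j => (i, j) ∈ droppedPairs B t)]
  have hz : ∑ j with (i, j) ∉ droppedPairs B t, restrict Θ (droppedPairs B t) i j ^ 2 = 0 :=
    Finset.sum_eq_zero fun j hj => by
      simp [restrict, (Finset.mem_filter.mp hj).2]
  have hmem : ∀ j, (i, j) ∈ droppedPairs B t → i ≠ j ∧ j ∈ droppedAt B t i := fun j hj => by
    simp only [droppedPairs, Finset.mem_filter] at hj
    exact ⟨hj.2.1, hj.2.2.1⟩
  rw [hz, add_zero]
  refine (Finset.sum_le_sum fun j hj => ?_).trans (Finset.sum_le_sum_of_subset_of_nonneg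
    (fun j hj => (hmem j (Finset.mem_filter.mp hj).2).2) fun _ _ _ => by positivity)
  have hj' := (Finset.mem_filter.mp hj).2
  have hne : j ≠ i := (hmem j hj').1.symm
  simp only [restrict, Matrix.of_apply, hj', if_true, regCoef, hne, if_false]
  refine le_of_eq ?_
  field_simp

theorem sum_sq_mul_essSparsity_le (n : ℕ) (Θ : Matrix (Fin p) (Fin p) ℝ) :
    ∑ i, Θ i i ^ 2 * essSparsity n Θ i ≤
      min ((totalEssSparsity n Θ : ℝ) * ⨆ i, Θ i i ^ 2)
        (maxEssSparsity n Θ * ‖Matrix.diagonal Θ.diag‖ ^ 2) := by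
  refine le_min ?_ ?_
  · rw [totalEssSparsity, Nat.cast_sum, Finset.sum_mul]
    refine Finset.sum_le_sum fun i _ => ?_
    rw [mul_comm]
    gcongr
    exact le_ciSup (f := fun i => Θ i i ^ 2) (Set.finite_range _).bddAbove i
  · rw [frobenius_norm_diagonal_sq, Finset.mul_sum]
    refine Finset.sum_le_sum fun i _ => ?_
    rw [mul_comm]
    gcongr
    exact Finset.le_sup (f := essSparsity n Θ) (Finset.mem_univ i)

theorem sqrt_min_mul_eq {Θ : Matrix (Fin p) (Fin p) ℝ} (h : 0 < totalEssSparsity n Θ)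
    (c : ℝ) :
    √(min ((totalEssSparsity n Θ : ℝ) * ⨆ i, Θ i i ^ 2)
        (maxEssSparsity n Θ * ‖Matrix.diagonal Θ.diag‖ ^ 2)) * √c =
      √(totalEssSparsity n Θ * c) * constCdiag n Θ := by
  have h' : (0 : ℝ) < totalEssSparsity n Θ := by exact_mod_cast h
  have e : min ((totalEssSparsity n Θ : ℝ) * ⨆ i, Θ i i ^ 2)
        (maxEssSparsity n Θ * ‖Matrix.diagonal Θ.diag‖ ^ 2) =
      totalEssSparsity n Θ * min (⨆ i, Θ i i ^ 2)
        ((maxEssSparsity n Θ : ℝ) / totalEssSparsity n Θ * ‖Matrix.diagonal Θ.diag‖ ^ 2) := by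
    rw [mul_min_of_nonneg _ _ h'.le]
    congr 1
    field_simp
  rw [e, constCdiag, Real.sqrt_mul h'.le, Real.sqrt_mul h'.le]
  ring

theorem maxEssSparsity_le_total (n : ℕ) (Θ : Matrix (Fin p) (Fin p) ℝ) :
    maxEssSparsity n Θ ≤ totalEssSparsity n Θ :=
  Finset.sup_le fun i _ =>
    Finset.single_le_sum (f := essSparsity n Θ) (fun _ _ => Nat.zero_le _) (Finset.mem_univ i)

end Gelato

/-! ### The main theorem: assembling the rows -/

open Gelato
theorem mainTheorem9
    {n p : ℕ} (hn : 1 ≤ n)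
    -- the population covariance matrix and its structural assumptions
    (S : Matrix (Fin p) (Fin p) ℝ) (hS : S.PosDef) (hSdiag : ∀ i, S i i = 1)
    (hRE : RE (maxEssSparsity n S⁻¹) 4 (popNorm S))
    (hρ : 0 < sparseMin (popNorm S) (maxDegree S⁻¹))
    -- the sample
    {Ω : Type*} [MeasurableSpace Ω] (P : Measure Ω) [IsProbabilityMeasure P]
    (X : Fin n → Ω → EuclideanSpace ℝ (Fin p))
    (hXindep : iIndepFun X P)
    (hXlaw : ∀ r, HasLaw (X r) (multivariateGaussian 0 S) P)
    -- tuning constants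
    (θ a c₀ D₄ : ℝ) (hθ0 : 0 < θ) (hθ1 : θ < 1) (ha : 6 ≤ a)
    (hc₀ : 4 * √2 ≤ c₀) (hd₀ : 2 * (1 + θ) * √(1 + a) ≤ d0 n S c₀ θ) (hD₄ : 0 < D₄) :
    -- on the event `C_a ∩ 𝒳`
    ∀ ω ∈ {ω | EventC S⁻¹ a (Matrix.of fun r j => X r ω j)} ∩
        {ω | EventX S θ (Matrix.of fun r j => X r ω j)},
    -- for every choice of optimal solutions of the nodewise Lasso
    ∀ B : Fin p → Fin p → ℝ,
      (∀ i, IsLassoSolution (Matrix.of fun r j => X r ω j) i (d0 n S c₀ θ * lam n p) (B i)) →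
      let t₀ := D₄ * d0 n S c₀ θ * lam n p
      let E := selectedEdges B t₀
      let Θ := S⁻¹
      let S₀ : ℝ := totalEssSparsity n Θ
      let s₀ : ℝ := maxEssSparsity n Θ
      let D₀ := constD0 n S c₀ θ
      let D₁ := constD1 n S c₀ θ
      (E.card : ℝ) ≤ 2 * (1 + D₁ / D₄) * S₀ ∧
      ((E \ trueEdges Θ).card : ℝ) ≤ 2 * D₁ / D₄ * S₀ ∧
      ‖restrict Θ (droppedPairs B t₀)‖ = ‖thetaTilde Θ E - Θ‖ ∧
      ‖thetaTilde Θ E - Θ‖ ≤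
        √(min (S₀ * ⨆ i, Θ i i ^ 2) (s₀ * ‖Matrix.diagonal Θ.diag‖ ^ 2))
          * √(1 + (D₀ + D₄) ^ 2) * d0 n S c₀ θ * lam n p ∧
      √(min (S₀ * ⨆ i, Θ i i ^ 2) (s₀ * ‖Matrix.diagonal Θ.diag‖ ^ 2))
          * √(1 + (D₀ + D₄) ^ 2) * d0 n S c₀ θ * lam n p =
        √(S₀ * (1 + (D₀ + D₄) ^ 2)) * constCdiag n Θ * d0 n S c₀ θ * lam n p ∧
      (D₁ ≤ D₄ → (E.card : ℝ) ≤ 4 * S₀ ∧ ((E \ trueEdges Θ).card : ℝ) ≤ 2 * S₀) := by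
  rintro ω ⟨hC, hX⟩ B hB t₀ E Θ S₀ s₀ D₀ D₁
  -- For `s = 0` the minimal sparse eigenvalue is the infimum of the empty set, which is 0 by
  -- convention and contradicts `hρ`.
  have hs : 1 ≤ maxDegree S⁻¹ := by
    by_contra hlt
    have h0 : maxDegree S⁻¹ = 0 := by omega
    have hempty : sparseRatios (popNorm S) 0 = ∅ := by
      rw [Set.eq_empty_iff_forall_notMem]
      rintro x ⟨v, hv, hcard, -⟩
      refine hv (funext fun j => ?_)
      have := Finset.card_eq_zero.mp (Nat.le_zero.mp hcard)
      simpa using (Finset.filter_eq_empty_iff.mp this) (Finset.mem_univ j)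
    rw [h0, sparseMin, hempty, Real.sInf_empty] at hρ
    exact lt_irrefl _ hρ
  have hlam : 0 < lam n p := lam_pos hn (by have := hRE.1; have := hRE.2.1; omega)
  have hΘ : ∀ i, 1 ≤ Θ i i := one_le_inv_diag hS hSdiag
  have hd1 : 1 ≤ d0 n S c₀ θ := by
    have : 1 ≤ √(1 + a) := Real.one_le_sqrt.mpr (by linarith)
    nlinarith
  have hd0 : 0 < d0 n S c₀ θ := by linarith
  have hμ : 0 < d0 n S c₀ θ * lam n p := mul_pos hd0 hlam
  have ht₀ : t₀ = D₄ * (d0 n S c₀ θ * lam n p) := mul_assoc _ _ _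
  have ht₀pos : 0 < t₀ := by rw [ht₀]; positivity
  have hK := one_le_reK_popNorm hSdiag hRE
  have hD₁ : 0 ≤ D₁ :=
    le_trans (by positivity) (nine_fourths_mul_sq_le_constD1 hθ0 hθ1 hd0.le (by linarith))
  have hS₀pos : 0 < totalEssSparsity n Θ := hRE.1.trans (maxEssSparsity_le_total n Θ)
  have hbounds : ∀ i, l1On (largeCoefs n Θ i)ᶜ (Function.update (B i) i 0) ≤
        D₁ * (d0 n S c₀ θ * lam n p * essSparsity n Θ i) ∧
      l2On (largeCoefs n Θ i) (Function.update (B i) i 0 - regCoef Θ i) ≤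
        D₀ * (d0 n S c₀ θ * lam n p * √(essSparsity n Θ i)) := fun i =>
    nodewise_lasso_bounds hn hS hSdiag hRE hs hθ0 hθ1 hc₀ hd₀ hd0 hC hX
      (fun b' => by rw [lassoObjective_update]; exact hB i b') (by simp)
  have hfalse : ∀ i, ((keptAt B t₀ i \ largeCoefs n Θ i).card : ℝ) ≤
      D₁ / D₄ * essSparsity n Θ i := fun i => by
    have h1 := card_mul_le_l1On (J := keptAt B t₀ i) (T := largeCoefs n Θ i)
      (b := Function.update (B i) i 0) (t := t₀) fun j hj => by
        have hj' := (Finset.mem_filter.mp hj).2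
        rw [Function.update_of_ne hj'.1]
        exact hj'.2
    have h2 := h1.trans (hbounds i).1
    have h3 := congrArg (((keptAt B t₀ i \ largeCoefs n Θ i).card : ℝ) * ·) ht₀
    rw [div_mul_eq_mul_div, le_div_iff₀ hD₄]
    refine le_of_mul_le_mul_right ?_ hμ
    linarith
  have hsum : (∑ i, (essSparsity n Θ i : ℝ)) = S₀ := by
    simp [S₀, totalEssSparsity]
  have hcardE : (E.card : ℝ) ≤ 2 * (1 + D₁ / D₄) * S₀ := by
    have h1 : (E.card : ℝ) ≤ 2 * ∑ i, ((keptAt B t₀ i).card : ℝ) := by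
      exact_mod_cast card_le_two_mul_sum_of_or fun e he => mem_keptAt_or_of_mem_selectedEdges he
    have h2 : ∀ i, ((keptAt B t₀ i).card : ℝ) ≤ (1 + D₁ / D₄) * essSparsity n Θ i := fun i => by
      have e1 : ((keptAt B t₀ i).card : ℝ) ≤
          (keptAt B t₀ i \ largeCoefs n Θ i).card + (largeCoefs n Θ i).card := by
        exact_mod_cast Finset.card_le_card_sdiff_add_card
      have e2 : ((largeCoefs n Θ i).card : ℝ) ≤ essSparsity n Θ i := by
        exact_mod_cast card_largeCoefs_le hlam (hΘ i)
      linarith [hfalse i]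
    calc (E.card : ℝ) ≤ 2 * ∑ i, (1 + D₁ / D₄) * (essSparsity n Θ i : ℝ) :=
          h1.trans (by gcongr with i; exact h2 i)
      _ = 2 * (1 + D₁ / D₄) * S₀ := by rw [← Finset.mul_sum, hsum]; ring
  have hsymm : ∀ i j, Θ i j = Θ j i := fun i j => by
    simpa using (hS.inv.isHermitian.apply i j).symm
  have hcardF : ((E \ trueEdges Θ).card : ℝ) ≤ 2 * D₁ / D₄ * S₀ := by
    have h1 : ((E \ trueEdges Θ).card : ℝ) ≤
        2 * ∑ i, ((keptAt B t₀ i \ largeCoefs n Θ i).card : ℝ) := by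
      have h := card_le_two_mul_sum_of_or (E := E \ trueEdges Θ)
        (I := fun i => keptAt B t₀ i \ largeCoefs n Θ i) fun e he => by
          obtain ⟨heE, heT⟩ := Finset.mem_sdiff.mp he
          have hne : e.1 ≠ e.2 := (Finset.mem_filter.mp heE).2.1
          have hz : Θ e.1 e.2 = 0 := by
            by_contra hnz
            exact heT (by simp [trueEdges, hne, hnz])
          simp only [Finset.mem_sdiff]
          refine (mem_keptAt_or_of_mem_selectedEdges heE).imp (fun h => ⟨h, fun hl => ?_⟩)
            fun h => ⟨h, fun hl => ?_⟩
          -- A large coefficient marks a true edge, so a false edge can only come from kept indices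
          -- outside `largeCoefs`; symmetry of `Θ` covers the other orientation.
          · exact apply_ne_zero_of_mem_largeCoefs hlam (hΘ _) hl hz
          · exact apply_ne_zero_of_mem_largeCoefs hlam (hΘ _) hl ((hsymm _ _).trans hz)
      exact_mod_cast h
    calc ((E \ trueEdges Θ).card : ℝ) ≤ 2 * ∑ i, D₁ / D₄ * (essSparsity n Θ i : ℝ) :=
          h1.trans (by gcongr with i; exact hfalse i)
      _ = 2 * D₁ / D₄ * S₀ := by rw [← Finset.mul_sum, hsum]; ring
  have hnorm : ‖restrict Θ (droppedPairs B t₀)‖ = ‖thetaTilde Θ E - Θ‖ := by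
    rw [thetaTilde_sub_eq, norm_neg]
  have hrow : ∀ i, ∑ j, restrict Θ (droppedPairs B t₀) i j ^ 2 ≤
      Θ i i ^ 2 * essSparsity n Θ i *
        ((1 + (D₀ + D₄) ^ 2) * (d0 n S c₀ θ * lam n p) ^ 2) := fun i => by
    have h1 := sum_sq_restrict_row (by linarith [hΘ i] : Θ i i ≠ 0) B t₀
    have h2 := sum_sq_dropped_le (b := Function.update (B i) i 0) (β := regCoef Θ i)
      (D := droppedAt B t₀ i) ht₀pos.le (fun j hj => by
        have hj' := (Finset.mem_filter.mp hj).2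
        rw [Function.update_of_ne hj'.1]
        exact hj'.2.le) (card_largeCoefs_le hlam (hΘ i))
    have h3 : √(essSparsity n Θ i) * t₀ +
          l2On (largeCoefs n Θ i) (Function.update (B i) i 0 - regCoef Θ i) ≤
        √(essSparsity n Θ i) * ((D₀ + D₄) * (d0 n S c₀ θ * lam n p)) := by
      rw [ht₀]
      linarith [(hbounds i).2]
    have h4 := pow_le_pow_left₀ (add_nonneg (by positivity) (l2On_nonneg _ _)) h3 2
    rw [mul_pow, Real.sq_sqrt (Nat.cast_nonneg _)] at h4
    -- The tail is of order `λ²`; `d₀ ≥ 1` lets it be absorbed as the summand 1 in `1 + (D₀ + D₄)²`.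
    have h5 : (essSparsity n Θ i : ℝ) * lam n p ^ 2 ≤
        essSparsity n Θ i * (d0 n S c₀ θ * lam n p) ^ 2 := by
      gcongr
      nlinarith
    have h6 := sum_compl_largeCoefs_le hlam (hΘ i)
    refine h1.trans ?_
    rw [mul_assoc]
    gcongr
    linarith
  have hbound : ‖thetaTilde Θ E - Θ‖ ≤
      √(min (S₀ * ⨆ i, Θ i i ^ 2) (s₀ * ‖Matrix.diagonal Θ.diag‖ ^ 2))
        * √(1 + (D₀ + D₄) ^ 2) * d0 n S c₀ θ * lam n p := by
    have hmin := sum_sq_mul_essSparsity_le n Θ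
    have hminnn : 0 ≤ min (S₀ * ⨆ i, Θ i i ^ 2) (s₀ * ‖Matrix.diagonal Θ.diag‖ ^ 2) :=
      le_trans (Finset.sum_nonneg fun _ _ => by positivity) hmin
    rw [← hnorm, mul_assoc _ (d0 n S c₀ θ)]
    refine (sq_le_sq₀ (norm_nonneg _) (by positivity)).mp ?_
    rw [frobenius_norm_sq, mul_pow, mul_pow, Real.sq_sqrt hminnn, Real.sq_sqrt (by positivity),
      mul_assoc]
    refine (Finset.sum_le_sum fun i _ => hrow i).trans ?_
    rw [← Finset.sum_mul]
    gcongr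
  refine ⟨hcardE, hcardF, hnorm, hbound, ?_, fun hD => ?_⟩
  · rw [sqrt_min_mul_eq hS₀pos]
  · have h1 : D₁ / D₄ ≤ 1 := (div_le_one hD₄).mpr hD
    have h0 : 0 ≤ S₀ := Nat.cast_nonneg _
    rw [mul_div_assoc] at hcardF
    constructor <;> nlinarith
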